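/- **Setting.** Let $K$ agents act at the times $t=1,\dots,n$. The state spaces $\mathbb X_t$, observation spaces $\mathbb Y_t^k$ and action spaces $\mathbb U_t^k$ are non-empty standard Borel spaces. The network is given by the law $S_1$ of $X_1$ and stochastic kernels $S_{t+1}(dx_{t+1}|x_t,u_t^{(K)})$, $Q_1^k(dy_1^k|x_1)$, $Q_{t+1}^k(dy_{t+1}^k|x_{t+1},u_t^{(K)})$; given the state and the previous actions, the observations of different agents are independent. Let $T\ge 1$ be the sharing delay. Put $\Delta_t=\{Y_s^j,U_s^j: s\le t-T,\ 1\le j\le K\}$ (shared data), $\Lambda_t^k=\{Y_s^k: t-T<s\le t\}\cup\{U_s^k: t-T<s<t\}$ (private data), $I_t^k=(\Delta_t,\Lambda_t^k)$. A strategy $\gamma^k$ of agent $k$ consists of measurable maps $U_t^k=\gamma_t^k(I_t^k)$; a profile $\gamma=(\gamma^1,\dots,\gamma^K)$ determines the joint law $\mathbb P^\gamma$. The running costs $\ell(t,x,u^{(K)})$ are real-valued, measurable and bounded from below, and all expectations are taken in $(-\infty,+\infty]$. Let $J_n(\gamma)=\mathbb E^\gamma\sum_{t=1}^n\ell(t,X_t,U_t^{(K)})$.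 A profile $\gamma^o$ is a *decentralized team equilibrium* if $J_n(\gamma^o)\le J_n(\gamma^k,\gamma^{-k,o})$ for all $k$ and all strategies $\gamma^k$ of agent $k$. Fix a profile $\gamma^o$. For each $k$ let $\xi_t^k[i]$ be the private posterior of $(X_t,\Lambda_t^{-k})$ given $I_t^k=i$, built recursively from $\gamma^{-k,o}$ alone by regular conditional laws: $\xi_1^k$ is the conditional law of $(X_1,\Lambda_1^{-k})$ given $I_1^k$; and $\xi_{t+1}^k$ is the conditional law of $(X_{t+1},\Lambda_{t+1}^{-k})$ given $Y_{t+1}^k$ and the data $Y_{t+1-T}^{-k},U_{t+1-T}^{-k}$ that become shared, when $(X_t,\Lambda_t^{-k})\sim\xi_t^k[i_t^k]$, $\Delta_t=\delta_t$, agent $k$ applies the action $u_t^k$ and the others use $\gamma_t^{-k,o}$. For a law $\xi$ of $(X_t,\Lambda_t^{-k})$ let $$P_{t+1}(dy_{t+1}^k,d\lambda_t^{-k},dx_t,dx_{t+1}|\xi,\delta_t,u)=Q_{t+1}^k(dy_{t+1}^k|x_{t+1},u,\gamma_t^{-k,o}(\delta_t,\lambda_t^{-k}))\,S_{t+1}(dx_{t+1}|x_t,u,\gamma_t^{-k,o}(\delta_t,\lambda_t^{-k}))\,\xi(dx_t,d\lambda_t^{-k}).$$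 Let $J_{t,n}^{\gamma^k,\gamma^{-k,o}}(i)$ be the expectation of $\sum_{j=t}^n\ell(j,X_j,U_j^{(K)})$ for the network started at time $t$ with $I_t^k=i$ and $(X_t,\Lambda_t^{-k})\sim\xi_t^k[i]$, and $\mathcal V_t^{\gamma^{k,o},\gamma^{-k,o}}(i)=\inf J_{t,n}^{\gamma^k,\gamma^{-k,o}}(i)$ over the strategies $\gamma^k$ that agree with $\gamma^{k,o}$ before $t$. For functions $W_1,\dots,W_n$ put $$G_t^W(\xi,i,u)=\int \ell(t,x_t,u,\gamma_t^{-k,o}(\delta_t,\lambda_t^{-k}))\,\xi(dx_t,d\lambda_t^{-k})+\int W_{t+1}(i,y_{t+1}^k,u,y_{t-T+1}^{-k},u_{t-T+1}^{-k})\,P_{t+1}(\cdot|\xi,\delta_t,u),$$ without the second term when $t=n$. The *DP equations* of agent $k$ are: $W_t$ is measurable and $W_t(i)=\inf_{u\in\mathbb U_t^k}G_t^W(\xi_t^k[i],i,u)$ for all $t\le n$ and all $i$. **Theorem.** Let $\gamma^o$ be any profile. (0) For every $k$, every strategy $\gamma^k$ and every $t$: $\xi_t^k$ does not depend on the strategy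 of agent $k$ and is a version of the conditional law of $(X_t,\Lambda_t^{-k})$ given $I_t^k$ under $\mathbb P^{\gamma^k,\gamma^{-k,o}}$; $J_{t,n}^{\gamma^k,\gamma^{-k,o}}(I_t^k)$ is a version of $\mathbb E^{\gamma^k,\gamma^{-k,o}}[\sum_{j\ge t}\ell(j,X_j,U_j^{(K)})|I_t^k]$; for $t<n$, $P_{t+1}(\cdot|\xi_t^k[i],\delta_t,u)$ is a version of the conditional law of $(Y_{t+1}^k,\Lambda_t^{-k},X_t,X_{t+1})$ given $I_t^k=i$, $U_t^k=u$ under $\mathbb P^{\gamma^k,\gamma^{-k,o}}$; and, for $t<n$, almost surely, for $\xi_t^k[I_t^k]$-almost every value of the unobserved quantities, $u_{t-T+1}^{-k}=\gamma_{t-T+1}^{-k,o}(\delta_{t-T+1},\lambda_{t-T+1}^{-k})$ when $t-T+1\ge1$, where all arguments except $y_{t-T+1}^{-k}$ are specified by $\delta_t$. (1.1) For every $k$, $\mathcal V_t^{\gamma^{k,o},\gamma^{-k,o}}=\mathcal V_t^{\gamma^{-k,o}}$ does not depend on $\gamma^{k,o}$. If the infima over $u$ of $G_t^{\mathcal V}(\xi_t^k[i],i,u)$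 are attained, for all $i$, at a measurable function of $i$ ($t\le n$), then $\mathcal V^{\gamma^{-k,o}}$ satisfies the DP equations of agent $k$; equivalently, $\mathcal V_n^{\gamma^{-k,o}}(i)=\inf_u\mathbb E^{\gamma^{-k,o}}\{\ell(n,X_n,u,\gamma_n^{-k,o})|i,u\}$ and $\mathcal V_t^{\gamma^{-k,o}}(i)=\inf_u\mathbb E^{\gamma^{-k,o}}\{\ell(t,X_t,u,\gamma_t^{-k,o})+\mathcal V_{t+1}^{\gamma^{-k,o}}(I_{t+1}^k)|i,u\}$ for $t<n$, the conditional expectations being integrals against $\xi_n^k[i]$ and $P_{t+1}(\cdot|\xi_t^k[i],\delta_t,u)$. (1.2) Let $\gamma^o$ be a decentralized team equilibrium, and suppose that for agent $k$ the infima over $u$ of $G_t^{\mathcal V}(\xi,i,u)$ are attained, for all probability measures $\xi$ and all $i$, at a measurable function of $(\xi,i)$. Then $\xi_{t+1}^k$ is a measurable function of $(\xi_t^k,\delta_t,u_t^k,y_{t+1}^k)$ and of the data $y_{t+1-T}^{-k},u_{t+1-T}^{-k}$ that become shared. There is a semi-separated strategy of agent $k$, $u_t^k=\varphi_t(\xi_t^k[i_t^k],\delta_t,\lambda_t^k)$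 for $t<n$ and $u_n^k=\varphi_n(\xi_n^k[i_n^k],\delta_n)$ with $\varphi_t$ measurable, that achieves the infima in the DP equations for all $i$, has cost-to-go $\mathcal V_t^{\gamma^{-k,o}}(i)$ for all $t$ and $i$, and has payoff $J_n(\gamma^o)$ against $\gamma^{-k,o}$. If $J_n(\gamma^o)<\infty$, then $\mathbb P^{\gamma^o}$-almost surely, for all $t$, $J_{t,n}^{\gamma^{o}}(I_t^k)=\mathcal V_t^{\gamma^{-k,o}}(I_t^k)$ and the action $\gamma_t^{k,o}(I_t^k)$ achieves the infimum in the DP equation. (2.1) If $W$ satisfies the DP equations of agent $k$, then $W_t(i)\le J_{t,n}^{\gamma^k,\gamma^{-k,o}}(i)$ for every strategy $\gamma^k$, every $t$ and every $i$ (in particular almost surely at $i=I_t^k$). (2.2) If for every $k$ there is a solution $W^k$ of the DP equations of agent $k$ such that $\gamma_t^{k,o}(i)$ achieves the infimum for all $t$ and $i$, then $\gamma^o$ is a decentralized team equilibrium, and $W_t^k(i)=J_{t,n}^{\gamma^{o}}(i)=\mathcal V_t^{\gamma^{-k,o}}(i)$ for all $k,t,i$. -/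

import Mathlib

open MeasureTheory ProbabilityTheory
open scoped ENNReal


noncomputable section

namespace DelayedSharing

/-! ### Extended expectation -/

/-- Expectation of an extended-real random variable, `E[f⁺] - E[f⁻]`.  It is the usual expectation
(possibly `+∞`) for every measurable `f` that is bounded from below. -/
def eint {α : Type*} [MeasurableSpace α] (μ : Measure α) (f : α → EReal) : EReal :=
  ((∫⁻ a, (f a).toENNReal ∂μ : ℝ≥0∞) : EReal) - ((∫⁻ a, (-f a).toENNReal ∂μ : ℝ≥0∞) : EReal)

/-- `J ∘ I` is a version of the conditional expectation `E[Z | I]` of an extended-real random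
variable `Z` that is bounded from below. -/
def IsCondExpectation {Ω β : Type*} [MeasurableSpace Ω] [MeasurableSpace β] (P : Measure Ω)
    (I : Ω → β) (Z : Ω → EReal) (J : β → EReal) : Prop :=
  Measurable J ∧ ∀ A : Set β, MeasurableSet A →
    eint P ((I ⁻¹' A).indicator Z) = eint P ((I ⁻¹' A).indicator (fun ω => J (I ω)))

/-! ### Product of finitely many stochastic kernels -/

/-- The kernel `a ↦ ∏ j, κ j (· | a)`. -/
def piKernel {ι α : Type*} [Fintype ι] [MeasurableSpace α] {β : ι → Type*}
    [∀ j, MeasurableSpace (β j)] (κ : ∀ j, Kernel α (β j)) [∀ j, IsMarkovKernel (κ j)] :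
    Kernel α (∀ j, β j) where
  toFun a := Measure.pi fun j => κ j a
  measurable' := by
    refine Measurable.measure_of_isPiSystem_of_isProbabilityMeasure
      generateFrom_pi.symm isPiSystem_pi ?_
    rintro _ ⟨s, hs, rfl⟩
    simp only [Measure.pi_pi]
    exact Finset.measurable_prod _ fun j _ => (κ j).measurable_coe (hs j (Set.mem_univ j))

instance {ι α : Type*} [Fintype ι] [MeasurableSpace α] {β : ι → Type*}
    [∀ j, MeasurableSpace (β j)] (κ : ∀ j, Kernel α (β j)) [∀ j, IsMarkovKernel (κ j)] :
    IsMarkovKernel (piKernel κ) :=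
  ⟨fun a => inferInstanceAs (IsProbabilityMeasure (Measure.pi fun j => κ j a))⟩

/-! ### Trajectories and the `T`-step delayed sharing information pattern

Times are numbered `0, 1, 2, …`; agents are the elements of the finite type `ι`. -/

section Patterns

variable {ι : Type*} (X : ℕ → Type*) (Y U : ℕ → ι → Type*) (T : ℕ)

/-- Trajectories of states, observations and actions. -/
abbrev Path := (∀ t, X t) × (∀ t j, Y t j) × (∀ t j, U t j)

/-- Values of the shared data `Δ_t = {Y_s^j, U_s^j : s ≤ t - T, all j}`. -/
abbrev Common (t : ℕ) := ∀ s : {s : ℕ // s + T ≤ t}, ∀ j, Y s j × U s j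

/-- Values of the private data `Λ_t^j = {Y_s^j : t - T < s ≤ t} ∪ {U_s^j : t - T < s < t}`. -/
abbrev Private (t : ℕ) (j : ι) :=
  (∀ s : {s : ℕ // s ≤ t ∧ t < s + T}, Y s j) × (∀ s : {s : ℕ // s < t ∧ t < s + T}, U s j)

/-- Values of the information `I_t^k = (Δ_t, Λ_t^k)` of agent `k`. -/
abbrev Info (t : ℕ) (k : ι) := Common Y U T t × Private Y U T t k

/-- Private data `Λ_t^{-k}` of all the agents other than `k`. -/
abbrev OthersPrivate (t : ℕ) (k : ι) := ∀ j : {j : ι // j ≠ k}, Private Y U T t j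

/-- Values of `(X_t, Λ_t^{-k})`, the quantities which agent `k` does not observe. -/
abbrev Hidden (t : ℕ) (k : ι) := X t × OthersPrivate Y U T t k

/-- What agent `k` learns between `t` and `t + 1`, besides its own action: its observation at
time `t + 1` and the data `Y_s^{-k}, U_s^{-k}`, `s = t + 1 - T`, that become shared. -/
abbrev NewData (t : ℕ) (k : ι) :=
  Y (t + 1) k × (∀ s : {s : ℕ // s + T = t + 1}, ∀ j : {j : ι // j ≠ k}, Y s j × U s j)

variable {X Y U}

def common (t : ℕ) (ω : Path X Y U) : Common Y U T t := fun s j => (ω.2.1 s j, ω.2.2 s j)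

def priv (t : ℕ) (j : ι) (ω : Path X Y U) : Private Y U T t j :=
  (fun s => ω.2.1 s j, fun s => ω.2.2 s j)

def info (t : ℕ) (k : ι) (ω : Path X Y U) : Info Y U T t k := (common T t ω, priv T t k ω)

def hidden (t : ℕ) (k : ι) (ω : Path X Y U) : Hidden X Y U T t k :=
  (ω.1 t, fun j => priv T t j.1 ω)

def newData (t : ℕ) (k : ι) (ω : Path X Y U) : NewData Y U T t k :=
  (ω.2.1 (t + 1) k, fun s j => (ω.2.1 s j, ω.2.2 s j))

section Fill

variable [∀ t, Nonempty (X t)] [∀ t j, Nonempty (Y t j)] [∀ t j, Nonempty (U t j)]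

/-- The trajectory with `X_t = x`, `Δ_t = δ`, `Λ_t = l`; all the other coordinates are
arbitrary (nothing below depends on them). -/
def fill (t : ℕ) (x : X t) (δ : Common Y U T t) (l : ∀ j, Private Y U T t j) : Path X Y U :=
  (Function.update (fun _ => Classical.arbitrary _) t x,
   fun s j => if h : s + T ≤ t then (δ ⟨s, h⟩ j).1
      else if h' : s ≤ t then (l j).1 ⟨s, h', not_le.mp h⟩ else Classical.arbitrary _,
   fun s j => if h : s + T ≤ t then (δ ⟨s, h⟩ j).2
      else if h' : s < t then (l j).2 ⟨s, h', not_le.mp h⟩ else Classical.arbitrary _)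

variable [DecidableEq ι]

/-- The trajectory determined up to time `t` by the information `i` of agent `k` and the value
`h` of what agent `k` does not observe. -/
def join (t : ℕ) (k : ι) (i : Info Y U T t k) (h : Hidden X Y U T t k) : Path X Y U :=
  fill T t h.1 i.1 ((Equiv.piSplitAt k fun j => Private Y U T t j).symm (i.2, h.2))

end Fill

/-- Replace the actions at time `t`. -/
def setAction (t : ℕ) (ω : Path X Y U) (a : ∀ j, U t j) : Path X Y U :=
  (ω.1, ω.2.1, Function.update ω.2.2 t a)

/-- Replace the state and the observations at time `t`. -/
def setState (t : ℕ) (ω : Path X Y U) (z : X t × ∀ j, Y t j) : Path X Y U :=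
  (Function.update ω.1 t z.1, Function.update ω.2.1 t z.2, ω.2.2)

/-- Replace the observation of agent `k` at time `t`. -/
def setObs [DecidableEq ι] (t : ℕ) (k : ι) (ω : Path X Y U) (y : Y t k) : Path X Y U :=
  (ω.1, Function.update ω.2.1 t (Function.update (ω.2.1 t) k y), ω.2.2)

end Patterns

/-! ### Strategies -/

section Strategies

variable {ι : Type*} (Y U : ℕ → ι → Type*) [∀ t j, MeasurableSpace (Y t j)]
  [∀ t j, MeasurableSpace (U t j)] (T : ℕ)

/-- Admissible strategies of agent `k`: a measurable function of `I_t^k` at every time `t`. -/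
abbrev Strategy (k : ι) := ∀ t, {g : Info Y U T t k → U t k // Measurable g}

/-- Strategy profiles `γ = (γ^j)_j`.  The profile `(γ^k, γ^{-k,o})` is
`Function.update γo k γk`. -/
abbrev Profile := ∀ k : ι, Strategy Y U T k

end Strategies

/-! ### The network -/

/-- A Markovian decentralized network: initial law and transition kernels of the state,
observation kernels of the agents, and a running cost that is bounded from below. -/
structure Network (ι : Type*) (X : ℕ → Type*) (Y U : ℕ → ι → Type*)
    [∀ t, MeasurableSpace (X t)] [∀ t j, MeasurableSpace (Y t j)]
    [∀ t j, MeasurableSpace (U t j)] where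
  /-- law of `X_0` -/
  S₀ : Measure (X 0)
  /-- law of `X_{t+1}` given `X_t` and the actions `U_t` -/
  S : ∀ t, Kernel (X t × ∀ j, U t j) (X (t + 1))
  /-- law of `Y_0^j` given `X_0` -/
  Q₀ : ∀ j, Kernel (X 0) (Y 0 j)
  /-- law of `Y_{t+1}^j` given `X_{t+1}` and the actions `U_t` -/
  Q : ∀ t j, Kernel (X (t + 1) × ∀ j, U t j) (Y (t + 1) j)
  /-- running cost at time `t` -/
  cost : ∀ t, X t → (∀ j, U t j) → ℝ
  prob_S₀ : IsProbabilityMeasure S₀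
  markov_S : ∀ t, IsMarkovKernel (S t)
  markov_Q₀ : ∀ j, IsMarkovKernel (Q₀ j)
  markov_Q : ∀ t j, IsMarkovKernel (Q t j)
  measurable_cost : ∀ t, Measurable fun p : X t × (∀ j, U t j) => cost t p.1 p.2
  cost_bddBelow : ∀ t, ∃ c : ℝ, ∀ x u, c ≤ cost t x u

attribute [instance] Network.prob_S₀ Network.markov_S Network.markov_Q₀ Network.markov_Q

section Model

variable {ι : Type*} [Fintype ι] [DecidableEq ι] {X : ℕ → Type*} {Y U : ℕ → ι → Type*}
  [∀ t, MeasurableSpace (X t)] [∀ t j, MeasurableSpace (Y t j)] [∀ t j, MeasurableSpace (U t j)]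
  [∀ t, Nonempty (X t)] [∀ t j, Nonempty (Y t j)] [∀ t j, Nonempty (U t j)]
  {T : ℕ}

/-- The actions at time `t` when agent `k` applies `u` and the others apply
`γ_t^{-k}(δ, λ^{-k})`. -/
def jointAction (γ : Profile Y U T) (k : ι) (t : ℕ) (δ : Common Y U T t)
    (l : OthersPrivate Y U T t k) (u : U t k) : ∀ j, U t j :=
  (Equiv.piSplitAt k (U t)).symm (u, fun j => (γ j t).1 (δ, l j))

/-- All agents act at time `t` according to `γ`. -/
def act (γ : Profile Y U T) (t : ℕ) (ω : Path X Y U) : Path X Y U :=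
  setAction t ω fun j => (γ j t).1 (info T t j ω)

/-- The trajectory up to the actions at time `t`, when `I_t^k = i`, `(X_t, Λ_t^{-k}) = h`, agent
`k` applies `u` and the others follow `γ^{-k}`. -/
def afterAction (γ : Profile Y U T) (k : ι) (t : ℕ) (i : Info Y U T t k)
    (h : Hidden X Y U T t k) (u : U t k) : Path X Y U :=
  setAction t (join T t k i h) (jointAction γ k t i.1 h.2 u)

/-- `I_{t+1}^k = (i, y_{t+1}^k, u_t^k, y_{t-T+1}^{-k}, u_{t-T+1}^{-k})`. -/
def nextInfo (γ : Profile Y U T) (k : ι) (t : ℕ) (i : Info Y U T t k)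
    (h : Hidden X Y U T t k) (u : U t k) (y : Y (t + 1) k) : Info Y U T (t + 1) k :=
  info T (t + 1) k (setObs (t + 1) k (afterAction γ k t i h u) y)

/-! Measurability of the maps above. -/

lemma measurable_piSplitAt_symm {β : ι → Type*} [∀ j, MeasurableSpace (β j)] (k : ι) :
    Measurable (Equiv.piSplitAt k β).symm := by
  refine measurable_pi_iff.mpr fun j => ?_
  by_cases h : j = k
  · subst h
    simpa [Equiv.piSplitAt] using measurable_fst
  · have : (fun x : β k × (∀ j : {j // j ≠ k}, β j) => (Equiv.piSplitAt k β).symm x j) =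
        fun x => x.2 ⟨j, h⟩ := by
      funext x; simp [Equiv.piSplitAt, h]
    rw [this]
    exact (measurable_pi_apply (⟨j, h⟩ : {j // j ≠ k})).comp measurable_snd

lemma measurable_info (t : ℕ) (k : ι) : Measurable (info T t k : Path X Y U → _) := by
  unfold info common priv; fun_prop

lemma measurable_hidden (t : ℕ) (k : ι) : Measurable (hidden T t k : Path X Y U → _) := by
  unfold hidden priv; fun_prop

lemma measurable_newData (t : ℕ) (k : ι) : Measurable (newData T t k : Path X Y U → _) := by
  unfold newData; fun_prop

lemma measurable_fill (t : ℕ) :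
    Measurable fun p : X t × Common Y U T t × (∀ j, Private Y U T t j) =>
      fill T t p.1 p.2.1 p.2.2 := by
  unfold fill
  refine Measurable.prodMk ((measurable_update _).comp measurable_fst) (Measurable.prodMk ?_ ?_)
  all_goals
    refine measurable_pi_iff.mpr fun s => measurable_pi_iff.mpr fun j => ?_
    by_cases h : s + T ≤ t
    · simp only [h, dite_true]; fun_prop
    · simp only [h, dite_false]
      split_ifs <;> fun_prop

lemma measurable_join (t : ℕ) (k : ι) :
    Measurable fun p : Info Y U T t k × Hidden X Y U T t k => join T t k p.1 p.2 := by
  have h : Measurable fun p : Info Y U T t k × Hidden X Y U T t k =>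
      (p.2.1, p.1.1, (Equiv.piSplitAt k fun j => Private Y U T t j).symm (p.1.2, p.2.2)) :=
    (by fun_prop : Measurable fun p : Info Y U T t k × Hidden X Y U T t k => p.2.1).prodMk
      ((by fun_prop : Measurable fun p : Info Y U T t k × Hidden X Y U T t k => p.1.1).prodMk
        ((measurable_piSplitAt_symm k).comp (by fun_prop)))
  exact (measurable_fill t).comp h

lemma measurable_setAction (t : ℕ) :
    Measurable fun p : Path X Y U × (∀ j, U t j) => setAction t p.1 p.2 := by
  unfold setAction
  exact (by fun_prop : Measurable fun p : Path X Y U × (∀ j, U t j) => p.1.1).prodMk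
    ((by fun_prop : Measurable fun p : Path X Y U × (∀ j, U t j) => p.1.2.1).prodMk
      (measurable_update'.comp
        (by fun_prop : Measurable fun p : Path X Y U × (∀ j, U t j) => (p.1.2.2, p.2))))

lemma measurable_setState (t : ℕ) :
    Measurable fun p : Path X Y U × (X t × ∀ j, Y t j) => setState t p.1 p.2 := by
  unfold setState
  exact (measurable_update'.comp
      (by fun_prop : Measurable fun p : Path X Y U × (X t × ∀ j, Y t j) => (p.1.1, p.2.1))).prodMk
    ((measurable_update'.comp
      (by fun_prop : Measurable fun p : Path X Y U × (X t × ∀ j, Y t j) =>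
        (p.1.2.1, p.2.2))).prodMk (by fun_prop))

lemma measurable_jointAction (γ : Profile Y U T) (k : ι) (t : ℕ) :
    Measurable fun p : Common Y U T t × OthersPrivate Y U T t k × U t k =>
      jointAction γ k t p.1 p.2.1 p.2.2 := by
  unfold jointAction
  refine (measurable_piSplitAt_symm k).comp (Measurable.prodMk (by fun_prop) ?_)
  exact measurable_pi_iff.mpr fun j => (γ j t).2.comp (by fun_prop)

lemma measurable_act (γ : Profile Y U T) (t : ℕ) :
    Measurable (act γ t : Path X Y U → Path X Y U) := by
  unfold act
  exact (measurable_setAction t).comp (measurable_id.prodMk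
    (measurable_pi_iff.mpr fun j => (γ j t).2.comp (measurable_info t j)))

/-- Parameters `(ξ, δ, u)`: a law of `(X_t, Λ_t^{-k})`, shared data, an action of agent `k`. -/
abbrev Belief (X : ℕ → Type*) (Y U : ℕ → ι → Type*)
    [∀ t, MeasurableSpace (X t)] [∀ t j, MeasurableSpace (Y t j)]
    [∀ t j, MeasurableSpace (U t j)] (T t : ℕ) (k : ι) :=
  ProbabilityMeasure (Hidden X Y U T t k) × Common Y U T t × U t k

/-- The kernel `(ξ, δ, u) ↦ ξ`. -/
def beliefKernel (t : ℕ) (k : ι) :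
    Kernel (Belief X Y U T t k) (Hidden X Y U T t k) where
  toFun p := (p.1 : Measure (Hidden X Y U T t k))
  measurable' := measurable_subtype_coe.comp measurable_fst

instance (t : ℕ) (k : ι) :
    IsMarkovKernel (beliefKernel t k : Kernel (Belief X Y U T t k) _) :=
  ⟨fun p => p.1.2⟩

/-- A trajectory that carries the information `i` of agent `k` at time `t`; the coordinates which
are not determined by `i` are arbitrary. -/
def ownPath (X : ℕ → Type*) [∀ t, Nonempty (X t)] (t : ℕ) (k : ι) (i : Info Y U T t k) :
    Path X Y U :=
  join T t k i (Classical.arbitrary _)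

lemma measurable_ownPath (t : ℕ) (k : ι) :
    Measurable (ownPath X t k : Info Y U T t k → Path X Y U) :=
  (measurable_join t k).comp (measurable_id.prodMk measurable_const)

/-- `I_t^k` as a function of `I_{t+1}^k`. -/
def prevInfo (X : ℕ → Type*) [∀ t, Nonempty (X t)] (t : ℕ) (k : ι) (i : Info Y U T (t + 1) k) :
    Info Y U T t k :=
  info T t k (ownPath X (t + 1) k i)

/-- `U_t^k` as a function of `I_{t+1}^k`. -/
def prevAction (X : ℕ → Type*) [∀ t, Nonempty (X t)] (t : ℕ) (k : ι)
    (i : Info Y U T (t + 1) k) : U t k :=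
  (ownPath X (t + 1) k i).2.2 t k

/-- The new data of agent `k` at time `t + 1` as a function of `I_{t+1}^k`. -/
def lastData (X : ℕ → Type*) [∀ t, Nonempty (X t)] (t : ℕ) (k : ι) (i : Info Y U T (t + 1) k) :
    NewData Y U T t k :=
  newData T t k (ownPath X (t + 1) k i)

/-! ### The law of the network under a strategy profile -/

namespace Network

variable (M : Network ι X Y U)

/-- Law of `X_0` and of the observations at time `0`, as a law on trajectories. -/
def initLaw : Measure (Path X Y U) :=
  (M.S₀ ⊗ₘ piKernel M.Q₀).map (setState 0 (Classical.arbitrary _))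

instance : IsProbabilityMeasure M.initLaw :=
  Measure.isProbabilityMeasure_map
    ((measurable_setState 0).comp (measurable_const.prodMk measurable_id)).aemeasurable

/-- Given the trajectory up to the actions at time `t`, draw `X_{t+1}` from
`S_{t+1}(· | X_t, U_t)` and then the observations from `∏_j Q_{t+1}^j(· | X_{t+1}, U_t)`. -/
def advance (t : ℕ) : Kernel (Path X Y U) (Path X Y U) :=
  (Kernel.id ×ₖ
    (((M.S t).comap (fun ω : Path X Y U => (ω.1 t, ω.2.2 t)) (by fun_prop)) ⊗ₖ
      ((piKernel (M.Q t)).comap (fun p : Path X Y U × X (t + 1) => (p.2, p.1.2.2 t))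
        (by fun_prop)))).map (fun p => setState (t + 1) p.1 p.2)

instance (t : ℕ) : IsMarkovKernel (M.advance t) :=
  Kernel.IsMarkovKernel.map _ (measurable_setState (t + 1))

/-- Evolution under the profile `γ` from time `t` (`X_t` and the observations at time `t`
already drawn) until the actions at time `t + m` are taken. -/
def run (γ : Profile Y U T) : ℕ → ℕ → Kernel (Path X Y U) (Path X Y U)
  | t, 0 => Kernel.deterministic (act γ t) (measurable_act γ t)
  | t, m + 1 => run γ (t + 1) m ∘ₖ
      (M.advance t ∘ₖ Kernel.deterministic (act γ t) (measurable_act γ t))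

instance (γ : Profile Y U T) (t m : ℕ) : IsMarkovKernel (M.run γ t m) := by
  induction m generalizing t with
  | zero => unfold run; infer_instance
  | succ m ih => unfold run; have := ih (t + 1); infer_instance

/-- The joint law `P^γ` of states, observations and actions at the times `0, …, N`. -/
def law (N : ℕ) (γ : Profile Y U T) : Measure (Path X Y U) := M.run γ 0 N ∘ₘ M.initLaw

instance (N : ℕ) (γ : Profile Y U T) : IsProbabilityMeasure (M.law N γ) := by
  unfold law; infer_instance

/-- Cost incurred at the times `t, …, N`. -/
def pathCost (N t : ℕ) (ω : Path X Y U) : EReal :=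
  ((∑ s ∈ Finset.Icc t N, M.cost s (ω.1 s) (ω.2.2 s) : ℝ) : EReal)

/-- The payoff `J_n(γ)`, for the horizon `0, …, N`, `n = N + 1`. -/
def payoff (N : ℕ) (γ : Profile Y U T) : EReal := eint (M.law N γ) (M.pathCost N 0)

/-- Decentralized sequential team equilibrium (person-by-person optimality). -/
def IsEquilibrium (N : ℕ) (γ : Profile Y U T) : Prop :=
  ∀ k, ∀ g : Strategy Y U T k, M.payoff N γ ≤ M.payoff N (Function.update γ k g)

/-! ### Private posterior -/

/-- Law of the trajectory up to the observations at time `t + 1` when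
`(X_t, Λ_t^{-k})` has law `ξ`, `Δ_t = δ`, agent `k` applies `u` and the others follow `γ^{-k}`.
(The private data of agent `k`, which do not matter here, are set to arbitrary values.) -/
def nextLaw (γ : Profile Y U T) (t : ℕ) (k : ι) : Kernel (Belief X Y U T t k) (Path X Y U) :=
  M.advance t ∘ₖ ((Kernel.id ×ₖ beliefKernel t k).map fun p =>
    setAction t (join T t k (p.1.2.1, Classical.arbitrary _) p.2)
      (jointAction γ k t p.1.2.1 p.2.2 p.1.2.2))

lemma measurable_nextLaw_aux (γ : Profile Y U T) (t : ℕ) (k : ι) :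
    Measurable fun p : Belief X Y U T t k × Hidden X Y U T t k =>
      setAction t (join T t k (p.1.2.1, Classical.arbitrary _) p.2)
        (jointAction γ k t p.1.2.1 p.2.2 p.1.2.2) := by
  refine (measurable_setAction t).comp (Measurable.prodMk ?_ ?_)
  · exact (measurable_join t k).comp (by fun_prop :
      Measurable fun p : Belief X Y U T t k × Hidden X Y U T t k =>
        (((p.1.2.1, Classical.arbitrary _) : Info Y U T t k), p.2))
  · exact (measurable_jointAction γ k t).comp (by fun_prop :
      Measurable fun p : Belief X Y U T t k × Hidden X Y U T t k => (p.1.2.1, p.2.2, p.1.2.2))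

instance (γ : Profile Y U T) (t : ℕ) (k : ι) : IsMarkovKernel (M.nextLaw γ t k) := by
  have := Kernel.IsMarkovKernel.map
    (Kernel.id ×ₖ (beliefKernel t k : Kernel (Belief X Y U T t k) (Hidden X Y U T t k)))
    (measurable_nextLaw_aux γ t k)
  unfold nextLaw
  infer_instance

/-- The transition law
`Q_{t+1}^k(dy | x', u, γ_t^{-k}(δ, λ^{-k})) S_{t+1}(dx' | x, u, γ_t^{-k}(δ, λ^{-k}))
ξ(dx, dλ^{-k})` of `((X_t, Λ_t^{-k}), X_{t+1}, Y_{t+1}^k)`, as a function of `(ξ, δ, u)`. -/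
def transition (γ : Profile Y U T) (t : ℕ) (k : ι) :
    Kernel (Belief X Y U T t k) (Hidden X Y U T t k × X (t + 1) × Y (t + 1) k) :=
  beliefKernel t k ⊗ₖ
    (((M.S t).comap (fun p : Belief X Y U T t k × Hidden X Y U T t k =>
        (p.2.1, jointAction γ k t p.1.2.1 p.2.2 p.1.2.2))
        (Measurable.prodMk (by fun_prop) ((measurable_jointAction γ k t).comp (by fun_prop :
          Measurable fun p : Belief X Y U T t k × Hidden X Y U T t k =>
            (p.1.2.1, p.2.2, p.1.2.2))))) ⊗ₖ
      ((M.Q t k).comap (fun p : (Belief X Y U T t k × Hidden X Y U T t k) × X (t + 1) =>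
        (p.2, jointAction γ k t p.1.1.2.1 p.1.2.2 p.1.1.2.2))
        (Measurable.prodMk (by fun_prop) ((measurable_jointAction γ k t).comp (by fun_prop :
          Measurable fun p : (Belief X Y U T t k × Hidden X Y U T t k) × X (t + 1) =>
            (p.1.1.2.1, p.1.2.2, p.1.1.2.2))))))

variable [∀ t, StandardBorelSpace (X t)] [∀ t j, StandardBorelSpace (Y t j)]
  [∀ t j, StandardBorelSpace (U t j)]

/-- One step of the posterior recursion: the conditional law of `(X_{t+1}, Λ_{t+1}^{-k})` given
the new data of agent `k`, under `nextLaw`. -/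
def filter (γ : Profile Y U T) (t : ℕ) (k : ι) :
    Kernel (Belief X Y U T t k × NewData Y U T t k) (Hidden X Y U T (t + 1) k) :=
  ((M.nextLaw γ t k).map fun ω => (newData T t k ω, hidden T (t + 1) k ω)).condKernel

instance (γ : Profile Y U T) (t : ℕ) (k : ι) : IsMarkovKernel (M.filter γ t k) := by
  unfold filter; infer_instance

/-- The private posterior `ξ_t^k[i] = P^{γ^{-k}}(dx_t, dλ_t^{-k} | I_t^k = i)`.  The actions of
agent `k` recorded in `i` enter as parameters; the strategy of agent `k` does not enter. -/
def posterior (γ : Profile Y U T) (k : ι) :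
    ∀ t, Info Y U T t k → ProbabilityMeasure (Hidden X Y U T t k)
  | 0, i => ⟨condDistrib (hidden T 0 k) (info T 0 k) M.initLaw i, inferInstance⟩
  | t + 1, i => ⟨M.filter γ t k
      ((posterior γ k t (prevInfo X t k i), (prevInfo X t k i).1, prevAction X t k i),
        lastData X t k i), inferInstance⟩

lemma measurable_posterior (γ : Profile Y U T) (k : ι) (t : ℕ) :
    Measurable (M.posterior γ k t) := by
  induction t with
  | zero =>
    exact Measurable.subtype_mk (condDistrib (hidden T 0 k) (info T 0 k) M.initLaw).measurable
  | succ t ih =>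
    have h1 : Measurable (prevInfo X t k : Info Y U T (t + 1) k → _) :=
      (measurable_info t k).comp (measurable_ownPath (t + 1) k)
    have h2 : Measurable (prevAction X t k : Info Y U T (t + 1) k → _) :=
      (by fun_prop : Measurable fun ω : Path X Y U => ω.2.2 t k).comp
        (measurable_ownPath (t + 1) k)
    have h3 : Measurable (lastData X t k : Info Y U T (t + 1) k → _) :=
      (measurable_newData t k).comp (measurable_ownPath (t + 1) k)
    exact Measurable.subtype_mk ((M.filter γ t k).measurable.comp
      (((ih.comp h1).prodMk ((measurable_fst.comp h1).prodMk h2)).prodMk h3))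

/-- The private posterior as a stochastic kernel. -/
def posteriorKernel (γ : Profile Y U T) (k : ι) (t : ℕ) :
    Kernel (Info Y U T t k) (Hidden X Y U T t k) where
  toFun i := (M.posterior γ k t i : Measure (Hidden X Y U T t k))
  measurable' := measurable_subtype_coe.comp (M.measurable_posterior γ k t)

/-- The transition law with `ξ = ξ_t^k[i]`, as a kernel from `(i, u)`. -/
def infoTransition (γ : Profile Y U T) (k : ι) (t : ℕ) :
    Kernel (Info Y U T t k × U t k) (Hidden X Y U T t k × X (t + 1) × Y (t + 1) k) :=
  (M.transition γ t k).comap (fun p => (M.posterior γ k t p.1, p.1.1, p.2))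
    (((M.measurable_posterior γ k t).comp measurable_fst).prodMk (by fun_prop))

/-- The private posterior is conditionally Markov: the next posterior is a measurable function
of the present posterior, the shared data, the action of agent `k`, its new observation and the
data of the other agents that become shared. -/
def IsConditionallyMarkov (γ : Profile Y U T) (k : ι) : Prop :=
  ∀ t, ∃ F : Belief X Y U T t k × NewData Y U T t k →
      ProbabilityMeasure (Hidden X Y U T (t + 1) k), Measurable F ∧
    ∀ i : Info Y U T (t + 1) k, M.posterior γ k (t + 1) i =
      F ((M.posterior γ k t (prevInfo X t k i), (prevInfo X t k i).1, prevAction X t k i),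
        lastData X t k i)

/-! ### Cost-to-go and value process -/

/-- Conditional law of the network given `I_t^k = i`, when the profile `γ` is used from time `t`
on. -/
def condLaw (N : ℕ) (γ : Profile Y U T) (k : ι) (t : ℕ) (i : Info Y U T t k) :
    Measure (Path X Y U) :=
  M.run γ t (N - t) ∘ₘ
    ((M.posterior γ k t i : Measure (Hidden X Y U T t k)).map (join T t k i))

/-- Cost-to-go `J_{t,n}^γ(i) = E^γ[∑_{s ≥ t} ℓ(s, X_s, U_s) | I_t^k = i]`. -/
def costToGo (N : ℕ) (γ : Profile Y U T) (k : ι) (t : ℕ) (i : Info Y U T t k) : EReal :=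
  eint (M.condLaw N γ k t i) (M.pathCost N t)

/-- Value process `𝒱_t^{γ^k, γ^{-k}}(i)`: infimum of the cost-to-go over the strategies of agent
`k` which use `γ^k` before time `t`. -/
def value (N : ℕ) (γ : Profile Y U T) (k : ι) (t : ℕ) (i : Info Y U T t k) : EReal :=
  ⨅ g : {g : Strategy Y U T k // ∀ s < t, g s = γ k s},
    M.costToGo N (Function.update γ k g.1) k t i

/-! ### Dynamic programming equations -/

/-- The running cost `ℓ(t, x_t, u, γ_t^{-k}(δ_t, λ_t^{-k}))`. -/
def actionCost (γ : Profile Y U T) (k : ι) (t : ℕ) (i : Info Y U T t k) (u : U t k)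
    (h : Hidden X Y U T t k) : EReal :=
  (M.cost t h.1 (jointAction γ k t i.1 h.2 u) : EReal)

/-- The term that is minimized in the dynamic programming equation,
`∫ ℓ(t, x_t, u, γ_t^{-k}(δ, λ^{-k})) ξ(dx_t, dλ^{-k})
  + ∫ W_{t+1}(i, y_{t+1}^k, u, y_{t-T+1}^{-k}, u_{t-T+1}^{-k}) P(dy_{t+1}^k, dλ^{-k}, dx_t, dx_{t+1} | ξ, δ, u)`,
where the second summand is absent at the last time `t = N`. -/
def dpCost (N : ℕ) (γ : Profile Y U T) (k : ι) (W : ∀ t, Info Y U T t k → EReal) (t : ℕ)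
    (ξ : ProbabilityMeasure (Hidden X Y U T t k)) (i : Info Y U T t k) (u : U t k) : EReal :=
  eint (ξ : Measure (Hidden X Y U T t k)) (M.actionCost γ k t i u) +
    if t < N then eint (M.transition γ t k (ξ, i.1, u))
      (fun z => W (t + 1) (nextInfo γ k t i z.1 u z.2.2)) else 0

/-- `W` solves the dynamic programming equations of agent `k` against `γ^{-k}`. -/
def IsDPSolution (N : ℕ) (γ : Profile Y U T) (k : ι) (W : ∀ t, Info Y U T t k → EReal) : Prop :=
  ∀ t ≤ N, Measurable (W t) ∧
    ∀ i, W t i = ⨅ u : U t k, M.dpCost N γ k W t (M.posterior γ k t i) i u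

/-- The strategy `g` achieves the infimum in the dynamic programming equations. -/
def IsMinimizer (N : ℕ) (γ : Profile Y U T) (k : ι) (W : ∀ t, Info Y U T t k → EReal)
    (g : Strategy Y U T k) : Prop :=
  ∀ t ≤ N, ∀ i, M.dpCost N γ k W t (M.posterior γ k t i) i ((g t).1 i) =
    ⨅ u : U t k, M.dpCost N γ k W t (M.posterior γ k t i) i u

/-- Measurable selectors: the minimum over the actions is attained, for all `(ξ, i)`, at a
measurable function of `(ξ, i)`. -/
def HasSelectors (N : ℕ) (γ : Profile Y U T) (k : ι) (W : ∀ t, Info Y U T t k → EReal) : Prop :=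
  ∀ t ≤ N, ∃ σ : ProbabilityMeasure (Hidden X Y U T t k) × Info Y U T t k → U t k,
    Measurable σ ∧ ∀ ξ i, M.dpCost N γ k W t ξ i (σ (ξ, i)) =
      ⨅ u : U t k, M.dpCost N γ k W t ξ i u

/-- Semi-separated strategies: `u_t^k = φ_t(ξ_t^k[i], δ_t, λ_t^k)` for `t < N`, and
`u_N^k = φ_N(ξ_N^k[i], δ_N)` at the last time. -/
def IsSemiSeparated (N : ℕ) (γ : Profile Y U T) (k : ι) (g : Strategy Y U T k) : Prop :=
  (∀ t < N, ∃ φ : ProbabilityMeasure (Hidden X Y U T t k) × Common Y U T t × Private Y U T t k →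
      U t k, Measurable φ ∧ ∀ i, (g t).1 i = φ (M.posterior γ k t i, i.1, i.2)) ∧
  ∃ φ : ProbabilityMeasure (Hidden X Y U T N k) × Common Y U T N → U N k,
    Measurable φ ∧ ∀ i, (g N).1 i = φ (M.posterior γ k N i, i.1)

end Network

end Model

end DelayedSharing

end

open DelayedSharing

/-! For a fixed profile `γ^{-k}` of the other agents, the law of `(I_t^k, X_t, Λ_t^{-k})`
disintegrates over the law of `I_t^k` along the private posterior, whatever agent `k` does: between
`t` and `t + 1`, the action of agent `k` enters only through its realized value, and what agent `k`
learns is a function of its own data and of `(Y_{t+1}^k, Y_{t+1-T}^{-k}, U_{t+1-T}^{-k})`, so that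
conditioning on these variables updates the posterior. The trajectory from time `t` on depends on
the past only through the state, `I_t^k` and `Λ_t^{-k}`. Consequently the cost-to-go of every
strategy of agent `k` satisfies the dynamic programming recursion without minimization, for every
value of the information, and backward induction compares it with the solutions of the dynamic
programming equations and with the value function.

Against an equilibrium profile, a minimizer cannot lower the payoff of agent `k`. So the
cost-to-go of `γ^k` and the value function, which lies below it, have the same expectation at the
first time. When this expectation is finite the two agree almost everywhere, and the recursion
propagates their equality and finiteness along almost every trajectory. -/

noncomputable section

namespace DelayedSharing

section ExtendedExpectation

variable {α β : Type*} [MeasurableSpace α] [MeasurableSpace β] {μ : Measure α}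

lemma coe_toENNReal_sub_coe_toENNReal_neg (x : EReal) :
    (x.toENNReal : EReal) - (-x).toENNReal = x := by
  rcases le_total 0 x with hx | hx
  · rw [EReal.coe_toENNReal hx, EReal.toENNReal_of_nonpos (by simpa using hx)]; simp
  · rw [EReal.toENNReal_of_nonpos hx, EReal.coe_toENNReal (by simpa using hx)]; simp

lemma coe_sub_coe_eq_of_add_eq_add {p q p' q' : ℝ≥0∞} (hq : q ≠ ∞) (hq' : q' ≠ ∞)
    (h : p + q' = p' + q) : (p : EReal) - q = (p' : EReal) - q' := by
  lift q to NNReal using hq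
  lift q' to NNReal using hq'
  rcases eq_or_ne p ∞ with rfl | hp
  · obtain rfl : p' = ∞ := by simpa using h.symm
    rfl
  have hp' : p' ≠ ∞ := fun hp' ↦ by simp [hp', hp] at h
  lift p to NNReal using hp
  lift p' to NNReal using hp'
  have h' : (p : ℝ) - q = p' - q' := by
    have : (p : ℝ) + q' = p' + q := by exact_mod_cast h
    linarith
  simp only [EReal.coe_nnreal_eq_coe_real]
  exact_mod_cast congrArg Real.toEReal h'

lemma coe_add_sub_coe_add {q q' : ℝ≥0∞} (hq : q ≠ ∞) (p p' : ℝ≥0∞) :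
    ((p + p' : ℝ≥0∞) : EReal) - ((q + q' : ℝ≥0∞) : EReal) = (p - q) + (p' - q') := by
  rw [EReal.coe_ennreal_add, EReal.coe_ennreal_add]
  exact EReal.add_sub_add_comm (.inl (EReal.coe_ennreal_ne_bot q))
    (.inl (by simpa [EReal.coe_ennreal_eq_top_iff] using hq))

lemma add_le_add_of_coe_sub_coe_le {p q p' q' : ℝ≥0∞} (hp : p ≠ ∞) (hq : q ≠ ∞)
    (hp' : p' ≠ ∞) (hq' : q' ≠ ∞) (h : (p : EReal) - q ≤ (p' : EReal) - q') :
    p + q' ≤ p' + q := by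
  lift p to NNReal using hp
  lift q to NNReal using hq
  lift p' to NNReal using hp'
  lift q' to NNReal using hq'
  simp only [EReal.coe_nnreal_eq_coe_real] at h
  have h' : (p : ℝ) - q ≤ p' - q' := by exact_mod_cast h
  have : (p : ℝ) + q' ≤ p' + q := by linarith
  exact_mod_cast this

lemma eint_mono {f g : α → EReal} (h : ∀ a, f a ≤ g a) : eint μ f ≤ eint μ g := by
  refine EReal.sub_le_sub ?_ ?_ <;> refine EReal.coe_ennreal_le_coe_ennreal_iff.mpr
    (lintegral_mono fun a ↦ EReal.toENNReal_le_toENNReal ?_)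
  exacts [h a, EReal.neg_le_neg_iff.mpr (h a)]

lemma eint_congr_ae {f g : α → EReal} (h : f =ᵐ[μ] g) : eint μ f = eint μ g := by
  unfold eint
  congr 2 <;> refine lintegral_congr_ae ?_
  exacts [h.fun_comp EReal.toENNReal, h.fun_comp fun x ↦ (-x).toENNReal]

lemma eint_map {g : α → β} (hg : Measurable g) {f : β → EReal} (hf : Measurable f) :
    eint (μ.map g) f = eint μ fun a ↦ f (g a) := by
  unfold eint
  rw [lintegral_map hf.ereal_toENNReal hg,
    lintegral_map (f := fun b ↦ (-f b).toENNReal) hf.neg.ereal_toENNReal hg]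

lemma eint_eq_of_map_eq {ν : Measure α} {f : α → EReal} (hf : Measurable f)
    (h : μ.map f = ν.map f) : eint μ f = eint ν f := by
  have hid := congrArg (fun ρ ↦ eint ρ id) h
  rwa [eint_map hf measurable_id, eint_map hf measurable_id] at hid

lemma eint_dirac (a : α) {f : α → EReal} (hf : Measurable f) :
    eint (Measure.dirac a) f = f a := by
  unfold eint
  rw [lintegral_dirac' _ hf.ereal_toENNReal,
    lintegral_dirac' (f := fun b ↦ (-f b).toENNReal) _ hf.neg.ereal_toENNReal,
    coe_toENNReal_sub_coe_toENNReal_neg]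

lemma eint_zero : eint μ (fun _ ↦ 0) = 0 := by simp [eint]

lemma eint_const [IsProbabilityMeasure μ] (x : EReal) : eint μ (fun _ ↦ x) = x := by
  simpa [eint] using coe_toENNReal_sub_coe_toENNReal_neg x

/-- Since `p` and `q` need not be the positive and negative parts of their difference, additivity
and the Fubini rules for `eint` reduce to the corresponding rules for `∫⁻`. -/
lemma eint_coe_sub_coe {p q : α → ℝ≥0∞} (hp : Measurable p) (hq : Measurable q)
    (hqint : ∫⁻ a, q a ∂μ ≠ ∞) :
    eint μ (fun a ↦ (p a : EReal) - q a)
      = ((∫⁻ a, p a ∂μ : ℝ≥0∞) : EReal) - ((∫⁻ a, q a ∂μ : ℝ≥0∞) : EReal) := by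
  have hpos : ∀ a, ((p a : EReal) - q a).toENNReal = p a - q a := fun a ↦ by
    rw [EReal.toENNReal_sub (EReal.coe_ennreal_nonneg _), EReal.toENNReal_coe,
      EReal.toENNReal_coe]
  have hneg : ∀ᵐ a ∂μ, (-((p a : EReal) - q a)).toENNReal = q a - p a := by
    filter_upwards [ae_lt_top hq hqint] with a ha
    rw [EReal.neg_sub (.inl (EReal.coe_ennreal_ne_bot _)) (.inr (by simpa using ha.ne)),
      add_comm, ← sub_eq_add_neg, EReal.toENNReal_sub (EReal.coe_ennreal_nonneg _),
      EReal.toENNReal_coe, EReal.toENNReal_coe]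
  unfold eint
  simp_rw [hpos]
  rw [lintegral_congr_ae hneg]
  refine coe_sub_coe_eq_of_add_eq_add
    (ne_top_of_le_ne_top hqint (lintegral_mono fun a ↦ tsub_le_self)) hqint ?_
  rw [← lintegral_add_right _ hq, ← lintegral_add_left hp]
  simp_rw [tsub_add_eq_max, add_tsub_eq_max]

/-- Measurable extended-real functions that are bounded from below by a real number: the class
of costs for which `eint` is a genuine expectation with values in `(-∞, +∞]`. -/
structure IsLowerBounded (f : α → EReal) : Prop where
  measurable : Measurable f
  exists_le : ∃ c : ℝ, ∀ a, (c : EReal) ≤ f a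

namespace IsLowerBounded

lemma ne_bot {f : α → EReal} (hf : IsLowerBounded f) (a : α) : f a ≠ ⊥ := by
  obtain ⟨c, hc⟩ := hf.exists_le
  exact ((EReal.bot_lt_coe c).trans_le (hc a)).ne'

lemma comp {f : β → EReal} (hf : IsLowerBounded f) {g : α → β} (hg : Measurable g) :
    IsLowerBounded fun a ↦ f (g a) :=
  ⟨hf.measurable.comp hg, hf.exists_le.imp fun _ hc a ↦ hc (g a)⟩

lemma indicator {f : α → EReal} (hf : IsLowerBounded f) {s : Set α} (hs : MeasurableSet s) :
    IsLowerBounded (s.indicator f) := by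
  obtain ⟨c, hc⟩ := hf.exists_le
  refine ⟨hf.measurable.indicator hs, min c 0, fun a ↦ ?_⟩
  by_cases ha : a ∈ s
  · rw [Set.indicator_of_mem ha]
    exact (EReal.coe_le_coe_iff.mpr (min_le_left c 0)).trans (hc a)
  · rw [Set.indicator_of_notMem ha]
    exact_mod_cast min_le_right c 0

lemma lintegral_neg_ne_top {f : α → EReal} (hf : IsLowerBounded f) [IsFiniteMeasure μ] :
    ∫⁻ a, (-f a).toENNReal ∂μ ≠ ∞ := by
  obtain ⟨c, hc⟩ := hf.exists_le
  refine ne_top_of_le_ne_top ?_ (lintegral_mono fun a ↦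
    EReal.toENNReal_le_toENNReal (EReal.neg_le_neg_iff.mpr (hc a)))
  rw [lintegral_const]
  exact ENNReal.mul_ne_top (by simp [← EReal.coe_neg]) (measure_ne_top μ _)

lemma eint_ne_bot {f : α → EReal} (hf : IsLowerBounded f) [IsFiniteMeasure μ] :
    eint μ f ≠ ⊥ := by
  simp [eint, sub_eq_add_neg, EReal.add_eq_bot_iff, EReal.neg_eq_bot_iff, hf.lintegral_neg_ne_top]

lemma eint_kernel {κ : Kernel α β} [IsMarkovKernel κ] {f : α × β → EReal}
    (hf : IsLowerBounded f) : IsLowerBounded fun a ↦ eint (κ a) fun b ↦ f (a, b) := by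
  obtain ⟨c, hc⟩ := hf.exists_le
  refine ⟨?_, c, fun a ↦ ?_⟩
  · refine (Measurable.coe_ereal_ennreal ?_).sub (Measurable.coe_ereal_ennreal ?_)
    · exact hf.measurable.ereal_toENNReal.lintegral_kernel_prod_right'
    · exact Measurable.lintegral_kernel_prod_right'
        (f := fun z ↦ (-f z).toENNReal) hf.measurable.neg.ereal_toENNReal
  · calc (c : EReal) = eint (κ a) fun _ ↦ (c : EReal) := (eint_const _).symm
      _ ≤ _ := eint_mono fun b ↦ hc (a, b)

end IsLowerBounded

lemma eint_add [IsFiniteMeasure μ] {f g : α → EReal} (hf : IsLowerBounded f)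
    (hg : IsLowerBounded g) : eint μ (fun a ↦ f a + g a) = eint μ f + eint μ g := by
  have hf₁ := hf.measurable.ereal_toENNReal
  have hf₂ : Measurable fun a ↦ (-f a).toENNReal := hf.measurable.neg.ereal_toENNReal
  have hsum : ∀ a, f a + g a = (((f a).toENNReal + (g a).toENNReal : ℝ≥0∞) : EReal)
      - (((-f a).toENNReal + (-g a).toENNReal : ℝ≥0∞) : EReal) := fun a ↦ by
    rw [coe_add_sub_coe_add, coe_toENNReal_sub_coe_toENNReal_neg,
      coe_toENNReal_sub_coe_toENNReal_neg]
    simpa [EReal.toENNReal_ne_top_iff] using hf.ne_bot a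
  simp_rw [hsum]
  rw [eint_coe_sub_coe, lintegral_add_left hf₁, lintegral_add_left hf₂,
    coe_add_sub_coe_add hf.lintegral_neg_ne_top, eint, eint]
  · exact hf₁.add hg.measurable.ereal_toENNReal
  · exact hf₂.add hg.measurable.neg.ereal_toENNReal
  · rw [lintegral_add_left hf₂]
    exact ENNReal.add_ne_top.mpr ⟨hf.lintegral_neg_ne_top, hg.lintegral_neg_ne_top⟩

lemma eint_comp [IsFiniteMeasure μ] {κ : Kernel α β} [IsFiniteKernel κ] {f : β → EReal}
    (hf : IsLowerBounded f) : eint (κ ∘ₘ μ) f = eint μ fun a ↦ eint (κ a) f := by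
  have hpos := hf.measurable.ereal_toENNReal
  have hneg : Measurable fun b ↦ (-f b).toENNReal := hf.measurable.neg.ereal_toENNReal
  have hfin := hf.lintegral_neg_ne_top (μ := κ ∘ₘ μ)
  rw [Measure.lintegral_bind κ.aemeasurable hneg.aemeasurable] at hfin
  refine Eq.trans ?_ (eint_coe_sub_coe hpos.lintegral_kernel hneg.lintegral_kernel hfin).symm
  rw [eint, Measure.lintegral_bind κ.aemeasurable hpos.aemeasurable,
    Measure.lintegral_bind κ.aemeasurable hneg.aemeasurable]

lemma eint_compProd [IsFiniteMeasure μ] {κ : Kernel α β} [IsFiniteKernel κ]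
    {f : α × β → EReal} (hf : IsLowerBounded f) :
    eint (μ ⊗ₘ κ) f = eint μ fun a ↦ eint (κ a) fun b ↦ f (a, b) := by
  have hpos := hf.measurable.ereal_toENNReal
  have hneg : Measurable fun z ↦ (-f z).toENNReal := hf.measurable.neg.ereal_toENNReal
  have hfin := hf.lintegral_neg_ne_top (μ := μ ⊗ₘ κ)
  rw [Measure.lintegral_compProd hneg] at hfin
  refine Eq.trans ?_ (eint_coe_sub_coe hpos.lintegral_kernel_prod_right'
    hneg.lintegral_kernel_prod_right' hfin).symm
  rw [eint, Measure.lintegral_compProd hpos, Measure.lintegral_compProd hneg]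

lemma eint_lt_top_iff [IsFiniteMeasure μ] {f : α → EReal} (hf : IsLowerBounded f) :
    eint μ f < ⊤ ↔ ∫⁻ a, (f a).toENNReal ∂μ ≠ ∞ := by
  rw [lt_top_iff_ne_top, eint, sub_eq_add_neg, EReal.add_ne_top_iff_ne_top_left]
  · exact EReal.coe_ennreal_eq_top_iff.not
  · simpa [EReal.neg_eq_bot_iff] using hf.lintegral_neg_ne_top
  · simp [EReal.neg_eq_top_iff]

lemma ae_lt_top_of_eint_lt_top [IsFiniteMeasure μ] {f : α → EReal} (hf : IsLowerBounded f)
    (hfin : eint μ f < ⊤) : ∀ᵐ a ∂μ, f a < ⊤ := by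
  filter_upwards [ae_lt_top hf.measurable.ereal_toENNReal ((eint_lt_top_iff hf).mp hfin)]
    with a ha
  simpa [lt_top_iff_ne_top, EReal.toENNReal_eq_top_iff] using ha

lemma ae_eq_of_eint_le [IsFiniteMeasure μ] {f g : α → EReal} (hf : IsLowerBounded f)
    (hg : IsLowerBounded g) (hfg : ∀ a, f a ≤ g a) (hle : eint μ g ≤ eint μ f)
    (hfin : eint μ f < ⊤) : f =ᵐ[μ] g := by
  have hpos : ∀ a, (f a).toENNReal ≤ (g a).toENNReal :=
    fun a ↦ EReal.toENNReal_le_toENNReal (hfg a)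
  have hneg : ∀ a, (-g a).toENNReal ≤ (-f a).toENNReal :=
    fun a ↦ EReal.toENNReal_le_toENNReal (EReal.neg_le_neg_iff.mpr (hfg a))
  have hfpos := (eint_lt_top_iff hf).mp hfin
  have hgpos := (eint_lt_top_iff hg).mp (hle.trans_lt hfin)
  have hfneg := hf.lintegral_neg_ne_top (μ := μ)
  have hgneg := hg.lintegral_neg_ne_top (μ := μ)
  have hle' : ∫⁻ a, (g a).toENNReal ∂μ + ∫⁻ a, (-f a).toENNReal ∂μ ≤
      ∫⁻ a, (f a).toENNReal ∂μ + ∫⁻ a, (-g a).toENNReal ∂μ :=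
    add_le_add_of_coe_sub_coe_le hgpos hgneg hfpos hfneg hle
  have hnegeq := ae_eq_of_ae_le_of_lintegral_le (ae_of_all μ hneg) hgneg
    hf.measurable.neg.ereal_toENNReal.aemeasurable
    ((ENNReal.add_le_add_iff_left hfpos).mp
      ((add_le_add_left (lintegral_mono hpos) _).trans hle'))
  have hposeq := ae_eq_of_ae_le_of_lintegral_le (ae_of_all μ hpos) hfpos
    hg.measurable.ereal_toENNReal.aemeasurable
    ((ENNReal.add_le_add_iff_right hgneg).mp
      ((add_le_add_right (lintegral_mono hneg) _).trans hle'))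
  filter_upwards [hposeq, hnegeq] with a ha ha'
  rw [← coe_toENNReal_sub_coe_toENNReal_neg (f a), ha, ← ha',
    coe_toENNReal_sub_coe_toENNReal_neg]

lemma ae_eq_and_lt_top_of_add_eint_le [IsFiniteMeasure μ] {f g : α → EReal}
    (hf : IsLowerBounded f) (hg : IsLowerBounded g) (hfg : ∀ a, f a ≤ g a) {x : EReal}
    (hx : x ≠ ⊥) (hle : x + eint μ g ≤ x + eint μ f) (hfin : x + eint μ g < ⊤) :
    ∀ᵐ a ∂μ, g a = f a ∧ g a < ⊤ := by
  obtain ⟨hxtop, hgfin⟩ := (EReal.add_ne_top_iff_ne_top₂ hx hg.eint_ne_bot).mp hfin.ne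
  lift x to ℝ using ⟨hxtop, hx⟩
  have hgle : eint μ g ≤ eint μ f :=
    (EReal.addLECancellable_coe x).add_le_add_iff_left.mp hle
  have hglt := lt_top_iff_ne_top.mpr hgfin
  filter_upwards [ae_eq_of_eint_le hf hg hfg hgle ((eint_mono hfg).trans_lt hglt),
    ae_lt_top_of_eint_lt_top hg hglt] with a heq hlt
  exact ⟨heq.symm, hlt⟩

lemma isCondExpectation_of_map_eq_compProd {Ω : Type*} [MeasurableSpace Ω] {P : Measure Ω}
    [IsFiniteMeasure P] {I : Ω → α} (hI : Measurable I) {H : Ω → β} (hH : Measurable H)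
    {κ : Kernel α β} [IsMarkovKernel κ]
    (h : P.map (fun ω ↦ (I ω, H ω)) = P.map I ⊗ₘ κ) {f : α × β → EReal} (hf : IsLowerBounded f) :
    IsCondExpectation P I (fun ω ↦ f (I ω, H ω)) fun a ↦ eint (κ a) fun b ↦ f (a, b) := by
  have hcond := hf.eint_kernel (κ := κ)
  refine ⟨hcond.measurable, fun A hA ↦ ?_⟩
  have hindicator := hf.indicator (hA.prod MeasurableSet.univ)
  calc eint P ((I ⁻¹' A).indicator fun ω ↦ f (I ω, H ω))
      = eint (P.map fun ω ↦ (I ω, H ω)) ((A ×ˢ Set.univ).indicator f) := by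
        rw [eint_map (hI.prodMk hH) hindicator.measurable]
        congr 1
        funext ω
        by_cases hω : I ω ∈ A <;> simp [hω]
    _ = eint (P.map I) fun a ↦ eint (κ a) fun b ↦ (A ×ˢ Set.univ).indicator f (a, b) := by
        rw [h, eint_compProd hindicator]
    _ = eint (P.map I) (A.indicator fun a ↦ eint (κ a) fun b ↦ f (a, b)) := by
        congr 1
        funext a
        by_cases ha : a ∈ A <;> simp [ha, eint_zero]
    _ = _ := eint_map hI (hcond.measurable.indicator hA)

end ExtendedExpectation

section Trajectories

variable {ι : Type*} {X : ℕ → Type*} {Y U : ℕ → ι → Type*} {T : ℕ}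

/-- Two trajectories have the same states at the times `t₀, …, t`, the same observations up to
time `t` and the same actions before time `t`. For `t₀ = t` this is what the network remembers
when the actions at time `t` are chosen. -/
def Agree (t₀ t : ℕ) (ω ω' : Path X Y U) : Prop :=
  (∀ s, t₀ ≤ s → s ≤ t → ω.1 s = ω'.1 s) ∧ (∀ s ≤ t, ω.2.1 s = ω'.2.1 s) ∧
    ∀ s < t, ω.2.2 s = ω'.2.2 s

lemma Agree.symm {t₀ t : ℕ} {ω ω' : Path X Y U} (h : Agree t₀ t ω ω') : Agree t₀ t ω' ω :=
  ⟨fun s h₀ hs ↦ (h.1 s h₀ hs).symm, fun s hs ↦ (h.2.1 s hs).symm, fun s hs ↦ (h.2.2 s hs).symm⟩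

lemma Agree.trans {t₀ t : ℕ} {ω ω' ω'' : Path X Y U} (h : Agree t₀ t ω ω')
    (h' : Agree t₀ t ω' ω'') : Agree t₀ t ω ω'' :=
  ⟨fun s h₀ hs ↦ (h.1 s h₀ hs).trans (h'.1 s h₀ hs),
    fun s hs ↦ (h.2.1 s hs).trans (h'.2.1 s hs), fun s hs ↦ (h.2.2 s hs).trans (h'.2.2 s hs)⟩

lemma Agree.mono {t₀ t₁ s t : ℕ} {ω ω' : Path X Y U} (h : Agree t₀ t ω ω') (h₀ : t₀ ≤ t₁)
    (hs : s ≤ t) : Agree t₁ s ω ω' :=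
  ⟨fun r h₁ hr ↦ h.1 r (h₀.trans h₁) (hr.trans hs), fun r hr ↦ h.2.1 r (hr.trans hs),
    fun r hr ↦ h.2.2 r (hr.trans_le hs)⟩

@[simp] lemma setAction_action (t : ℕ) (ω : Path X Y U) (a : ∀ j, U t j) :
    (setAction t ω a).2.2 t = a := by simp [setAction]

lemma agree_setAction (t : ℕ) (ω : Path X Y U) (a : ∀ j, U t j) :
    Agree 0 t ω (setAction t ω a) :=
  ⟨fun _ _ _ ↦ rfl, fun _ _ ↦ rfl, fun s hs ↦ by simp [setAction, Function.update_of_ne hs.ne]⟩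

lemma agree_setState (t : ℕ) (ω : Path X Y U) (z : X (t + 1) × ∀ j, Y (t + 1) j) :
    Agree 0 t ω (setState (t + 1) ω z) := by
  refine ⟨fun s _ hs ↦ ?_, fun s hs ↦ ?_, fun _ _ ↦ rfl⟩
  all_goals simp [setState, Function.update_of_ne (show s ≠ t + 1 by omega)]

lemma Agree.setState {t₀ t : ℕ} {ω ω' : Path X Y U} (h : Agree t₀ t ω ω')
    (hu : ω.2.2 t = ω'.2.2 t) (z : X (t + 1) × ∀ j, Y (t + 1) j) :
    Agree t₀ (t + 1) (setState (t + 1) ω z) (setState (t + 1) ω' z) := by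
  refine ⟨fun s h₀ hs ↦ ?_, fun s hs ↦ ?_, fun s hs ↦ ?_⟩
  · rcases hs.eq_or_lt with rfl | hs
    · simp [DelayedSharing.setState]
    · simpa [DelayedSharing.setState, Function.update_of_ne hs.ne] using h.1 s h₀ (by omega)
  · rcases hs.eq_or_lt with rfl | hs
    · simp [DelayedSharing.setState]
    · simpa [DelayedSharing.setState, Function.update_of_ne hs.ne] using h.2.1 s (by omega)
  · rcases (Nat.lt_succ_iff.mp hs).eq_or_lt with rfl | hs
    · exact hu
    · exact h.2.2 s hs

lemma info_ext {t : ℕ} {k : ι} {ω ω' : Path X Y U}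
    (hy : ∀ s j, s + T ≤ t → ω.2.1 s j = ω'.2.1 s j)
    (hu : ∀ s j, s + T ≤ t → ω.2.2 s j = ω'.2.2 s j)
    (hyk : ∀ s ≤ t, ω.2.1 s k = ω'.2.1 s k) (huk : ∀ s < t, ω.2.2 s k = ω'.2.2 s k) :
    info T t k ω = info T t k ω' := by
  refine Prod.ext ?_ (Prod.ext ?_ ?_)
  · funext s j; exact Prod.ext (hy s j s.2) (hu s j s.2)
  · funext s; exact hyk s s.2.1
  · funext s; exact huk s s.2.1

lemma Agree.info_eq {t₀ s t : ℕ} {ω ω' : Path X Y U} (h : Agree t₀ t ω ω') (hT : 1 ≤ T)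
    (hs : s ≤ t) (k : ι) : info T s k ω = info T s k ω' :=
  info_ext (fun r j hr ↦ by rw [h.2.1 r (by omega)]) (fun r j hr ↦ by rw [h.2.2 r (by omega)])
    (fun r hr ↦ by rw [h.2.1 r (by omega)]) (fun r hr ↦ by rw [h.2.2 r (by omega)])

lemma Agree.hidden_eq {t₀ s t : ℕ} {ω ω' : Path X Y U} (h : Agree t₀ t ω ω') (h₀ : t₀ ≤ s)
    (hs : s ≤ t) (k : ι) : hidden T s k ω = hidden T s k ω' := by
  refine Prod.ext (h.1 s h₀ hs) (funext fun j ↦ Prod.ext ?_ ?_)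
  · funext r; exact congrFun (h.2.1 r (r.2.1.trans hs)) _
  · funext r; exact congrFun (h.2.2 r (r.2.1.trans_le hs)) _

lemma obs_eq_of_info_eq {t : ℕ} {k : ι} {ω ω' : Path X Y U}
    (h : info T t k ω = info T t k ω') {s : ℕ} {j : ι} (hs : s + T ≤ t ∨ (j = k ∧ s ≤ t)) :
    ω.2.1 s j = ω'.2.1 s j := by
  by_cases hst : s + T ≤ t
  · exact congrArg Prod.fst (congrFun (congrFun (congrArg Prod.fst h) ⟨s, hst⟩) j)
  · obtain ⟨rfl, hst'⟩ := hs.resolve_left hst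
    exact congrFun (congrArg (fun i : Info Y U T t j ↦ i.2.1) h) ⟨s, hst', not_le.mp hst⟩

lemma action_eq_of_info_eq {t : ℕ} {k : ι} {ω ω' : Path X Y U}
    (h : info T t k ω = info T t k ω') {s : ℕ} {j : ι} (hs : s + T ≤ t ∨ (j = k ∧ s < t)) :
    ω.2.2 s j = ω'.2.2 s j := by
  by_cases hst : s + T ≤ t
  · exact congrArg Prod.snd (congrFun (congrFun (congrArg Prod.fst h) ⟨s, hst⟩) j)
  · obtain ⟨rfl, hst'⟩ := hs.resolve_left hst
    exact congrFun (congrArg (fun i : Info Y U T t j ↦ i.2.2) h) ⟨s, hst', not_le.mp hst⟩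

lemma info_eq_of_info_succ_eq {t : ℕ} {k : ι} {ω ω' : Path X Y U}
    (h : info T (t + 1) k ω = info T (t + 1) k ω') : info T t k ω = info T t k ω' :=
  info_ext (fun _ _ _ ↦ obs_eq_of_info_eq h (.inl (by omega)))
    (fun _ _ _ ↦ action_eq_of_info_eq h (.inl (by omega)))
    (fun _ _ ↦ obs_eq_of_info_eq h (.inr ⟨rfl, by omega⟩))
    (fun _ _ ↦ action_eq_of_info_eq h (.inr ⟨rfl, by omega⟩))

lemma newData_eq_of_info_succ_eq {t : ℕ} {k : ι} {ω ω' : Path X Y U}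
    (h : info T (t + 1) k ω = info T (t + 1) k ω') : newData T t k ω = newData T t k ω' :=
  Prod.ext (obs_eq_of_info_eq h (.inr ⟨rfl, le_rfl⟩)) (funext fun s ↦ funext fun _ ↦
    Prod.ext (obs_eq_of_info_eq h (.inl s.2.le)) (action_eq_of_info_eq h (.inl s.2.le)))

lemma info_succ_eq_of_newData_eq (hT : 1 ≤ T) {t : ℕ} {k : ι} {ω ω' : Path X Y U}
    (hi : info T t k ω = info T t k ω') (hu : ω.2.2 t k = ω'.2.2 t k)
    (hd : newData T t k ω = newData T t k ω') :
    info T (t + 1) k ω = info T (t + 1) k ω' := by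
  have hobs : ∀ s ≤ t + 1, ω.2.1 s k = ω'.2.1 s k := fun s hs ↦ by
    rcases hs.eq_or_lt with rfl | hs
    · exact congrArg Prod.fst hd
    · exact obs_eq_of_info_eq hi (.inr ⟨rfl, by omega⟩)
  have hact : ∀ s < t + 1, ω.2.2 s k = ω'.2.2 s k := fun s hs ↦ by
    rcases (Nat.lt_succ_iff.mp hs).eq_or_lt with rfl | hs
    · exact hu
    · exact action_eq_of_info_eq hi (.inr ⟨rfl, hs⟩)
  have hshared : ∀ s j, s + T ≤ t + 1 → j ≠ k →
      ω.2.1 s j = ω'.2.1 s j ∧ ω.2.2 s j = ω'.2.2 s j := fun s j hs hj ↦ by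
    rcases hs.eq_or_lt with hs | hs
    · exact Prod.ext_iff.mp (congrFun (congrFun (congrArg Prod.snd hd) ⟨s, hs⟩) ⟨j, hj⟩)
    · exact ⟨obs_eq_of_info_eq hi (.inl (by omega)), action_eq_of_info_eq hi (.inl (by omega))⟩
  refine info_ext (fun s j hs ↦ ?_) (fun s j hs ↦ ?_) hobs hact
  · rcases eq_or_ne j k with rfl | hj
    exacts [hobs s (by omega), (hshared s j hs hj).1]
  · rcases eq_or_ne j k with rfl | hj
    exacts [hact s (by omega), (hshared s j hs hj).2]

/-- At time `s = t + 1 - T` the private data of agent `j` consist of its observation at time `s`,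
everything else being already shared at time `t`. -/
lemma info_eq_of_common_eq (hT : 1 ≤ T) {t s : ℕ} (hs : s + T = t + 1) {j : ι}
    {ω ω' : Path X Y U} (h : common T t ω = common T t ω') (hy : ω.2.1 s j = ω'.2.1 s j) :
    info T s j ω = info T s j ω' := by
  have hshared : ∀ r i, r + T ≤ t → ω.2.1 r i = ω'.2.1 r i ∧ ω.2.2 r i = ω'.2.2 r i :=
    fun r i hr ↦ Prod.ext_iff.mp (congrFun (congrFun h ⟨r, hr⟩) i)
  refine info_ext (fun r i hr ↦ (hshared r i (by omega)).1)
    (fun r i hr ↦ (hshared r i (by omega)).2) (fun r hr ↦ ?_)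
    (fun r hr ↦ (hshared r j (by omega)).2)
  rcases hr.eq_or_lt with rfl | hr
  · exact hy
  · exact (hshared r j (by omega)).1

lemma info_setState [DecidableEq ι] (hT : 1 ≤ T) (t : ℕ) (k : ι) (ω : Path X Y U)
    (z : X (t + 1) × ∀ j, Y (t + 1) j) :
    info T (t + 1) k (setState (t + 1) ω z) =
      info T (t + 1) k (setObs (t + 1) k ω (z.2 k)) := by
  refine info_ext (fun s j hs ↦ ?_) (fun _ _ _ ↦ rfl) (fun s hs ↦ ?_) (fun _ _ ↦ rfl)
  · simp [setState, setObs, Function.update_of_ne (show s ≠ t + 1 by omega)]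
  · rcases hs.eq_or_lt with rfl | hs
    · simp [setState, setObs]
    · simp [setState, setObs, Function.update_of_ne hs.ne]

section NewData

variable [DecidableEq ι]

/-- Overwrite the data which agent `k` receives between `t` and `t + 1`. It exhibits `I_{t+1}^k` as
a measurable function of these data when `I_t^k` and `U_t^k` are fixed. -/
def setNewData (t : ℕ) (k : ι) (ω : Path X Y U) (d : NewData Y U T t k) : Path X Y U :=
  (ω.1,
    fun s j ↦ if h : s + T = t + 1 ∧ j ≠ k then (d.2 ⟨s, h.1⟩ ⟨j, h.2⟩).1
      else (setObs (t + 1) k ω d.1).2.1 s j,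
    fun s j ↦ if h : s + T = t + 1 ∧ j ≠ k then (d.2 ⟨s, h.1⟩ ⟨j, h.2⟩).2 else ω.2.2 s j)

lemma newData_setNewData (t : ℕ) (k : ι) (ω : Path X Y U) (d : NewData Y U T t k) :
    newData T t k (setNewData t k ω d) = d := by
  refine Prod.ext (by simp [newData, setNewData, setObs]) ?_
  funext s j
  simp [newData, setNewData, s.2, j.2]

lemma action_setNewData (t : ℕ) (k : ι) (ω : Path X Y U) (d : NewData Y U T t k) :
    (setNewData t k ω d).2.2 t k = ω.2.2 t k := by
  simp [setNewData]

lemma info_setNewData (hT : 1 ≤ T) (t : ℕ) (k : ι) (ω : Path X Y U) (d : NewData Y U T t k) :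
    info T t k (setNewData t k ω d) = info T t k ω := by
  refine info_ext (fun s j hs ↦ ?_) (fun s j hs ↦ ?_) (fun s hs ↦ ?_) (fun s _ ↦ ?_)
  · simp [setNewData, setObs, show s + T ≠ t + 1 by omega, show s ≠ t + 1 by omega]
  · simp [setNewData, show s + T ≠ t + 1 by omega]
  · simp [setNewData, setObs, show s ≠ t + 1 by omega]
  · simp [setNewData]

lemma info_succ_eq_info_setNewData (hT : 1 ≤ T) {t : ℕ} {k : ι} {ω ω₀ : Path X Y U}
    (hi : info T t k ω = info T t k ω₀) (hu : ω.2.2 t k = ω₀.2.2 t k) :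
    info T (t + 1) k ω = info T (t + 1) k (setNewData t k ω₀ (newData T t k ω)) :=
  info_succ_eq_of_newData_eq hT (by rw [info_setNewData hT, hi]) (by rw [action_setNewData, hu])
    (by rw [newData_setNewData])

end NewData

section Join

variable [DecidableEq ι] [∀ t, Nonempty (X t)] [∀ t j, Nonempty (Y t j)]
  [∀ t j, Nonempty (U t j)]

lemma agree_join (t : ℕ) (k : ι) (ω : Path X Y U) :
    Agree t t ω (join T t k (info T t k ω) (hidden T t k ω)) := by
  refine ⟨fun s h₀ hs ↦ ?_, fun s hs ↦ funext fun j ↦ ?_, fun s hs ↦ funext fun j ↦ ?_⟩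
  · obtain rfl : s = t := le_antisymm hs h₀
    simp [join, fill, hidden]
  all_goals
    by_cases hst : s + T ≤ t
    · simp [join, fill, hst, info, common]
    by_cases hj : j = k
    · subst hj; simp [join, fill, hst, hs, info, priv, Equiv.piSplitAt]
    · simp [join, fill, hst, hs, hidden, priv, Equiv.piSplitAt, hj]

lemma info_join (t : ℕ) (k : ι) (i : Info Y U T t k) (h : Hidden X Y U T t k) (j : ι) :
    info T t j (join T t k i h) =
      (i.1, (Equiv.piSplitAt k fun j ↦ Private Y U T t j).symm (i.2, h.2) j) := by
  refine Prod.ext ?_ (Prod.ext ?_ ?_)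
  · funext s j'
    simp [info, common, join, fill, s.2]
  all_goals
    funext s
    simp [info, priv, join, fill, not_le.mpr s.2.2, s.2.1]

@[simp] lemma info_join_self (t : ℕ) (k : ι) (i : Info Y U T t k) (h : Hidden X Y U T t k) :
    info T t k (join T t k i h) = i := by
  simp [info_join, Equiv.piSplitAt]

lemma info_join_of_ne (t : ℕ) (k : ι) (i : Info Y U T t k) (h : Hidden X Y U T t k)
    (j : {j // j ≠ k}) : info T t j.1 (join T t k i h) = (i.1, h.2 j) := by
  simp [info_join, Equiv.piSplitAt, j.2]

@[simp] lemma hidden_join (t : ℕ) (k : ι) (i : Info Y U T t k) (h : Hidden X Y U T t k) :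
    hidden T t k (join T t k i h) = h :=
  Prod.ext (by simp [hidden, join, fill])
    (funext fun j ↦ congrArg Prod.snd (info_join_of_ne t k i h j))

lemma info_ownPath (t : ℕ) (k : ι) (i : Info Y U T t k) : info T t k (ownPath X t k i) = i :=
  info_join_self t k i _

lemma prevInfo_info (t : ℕ) (k : ι) (ω : Path X Y U) :
    prevInfo X t k (info T (t + 1) k ω) = info T t k ω :=
  info_eq_of_info_succ_eq (info_ownPath (t + 1) k _)

lemma prevAction_info (t : ℕ) (k : ι) (ω : Path X Y U) :
    prevAction X t k (info T (t + 1) k ω) = ω.2.2 t k :=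
  action_eq_of_info_eq (info_ownPath (t + 1) k _) (.inr ⟨rfl, t.lt_succ_self⟩)

lemma lastData_info (t : ℕ) (k : ι) (ω : Path X Y U) :
    lastData X t k (info T (t + 1) k ω) = newData T t k ω :=
  newData_eq_of_info_succ_eq (info_ownPath (t + 1) k _)

end Join

end Trajectories

section Actions

variable {ι : Type*} {X : ℕ → Type*} {Y U : ℕ → ι → Type*}
  [∀ t j, MeasurableSpace (Y t j)] [∀ t j, MeasurableSpace (U t j)] {T : ℕ}

lemma agree_act (γ : Profile Y U T) (t : ℕ) (ω : Path X Y U) : Agree 0 t ω (act γ t ω) :=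
  agree_setAction t ω _

lemma Agree.act_action_eq {t₀ t : ℕ} {ω ω' : Path X Y U} (h : Agree t₀ t ω ω') (hT : 1 ≤ T)
    (γ : Profile Y U T) : (act γ t ω).2.2 t = (act γ t ω').2.2 t := by
  simp only [act, setAction_action]
  funext j
  rw [h.info_eq hT le_rfl]

lemma Agree.act {t₀ t : ℕ} {ω ω' : Path X Y U} (h : Agree t₀ t ω ω') (γ : Profile Y U T) :
    Agree t₀ t (act γ t ω) (act γ t ω') :=
  (((agree_act γ t ω).symm.mono t₀.zero_le le_rfl).trans h).trans
    ((agree_act γ t ω').mono t₀.zero_le le_rfl)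

section JointAction

variable [DecidableEq ι]

lemma jointAction_update (γ : Profile Y U T) (k : ι) (g : Strategy Y U T k) (t : ℕ)
    (δ : Common Y U T t) (l : OthersPrivate Y U T t k) (u : U t k) :
    jointAction (Function.update γ k g) k t δ l u = jointAction γ k t δ l u := by
  unfold jointAction
  congr 2
  funext j
  rw [Function.update_of_ne j.2]

@[simp] lemma jointAction_self (γ : Profile Y U T) (k : ι) (t : ℕ)
    (δ : Common Y U T t) (l : OthersPrivate Y U T t k) (u : U t k) :
    jointAction γ k t δ l u k = u := by
  simp [jointAction, Equiv.piSplitAt]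

lemma jointAction_of_ne (γ : Profile Y U T) (k : ι) (t : ℕ)
    (δ : Common Y U T t) (l : OthersPrivate Y U T t k) (u : U t k) {j : ι} (hj : j ≠ k) :
    jointAction γ k t δ l u j = (γ j t).1 (δ, l ⟨j, hj⟩) := by
  simp [jointAction, Equiv.piSplitAt, hj]

end JointAction

section AfterAction

variable [DecidableEq ι] [∀ t, Nonempty (X t)] [∀ t j, Nonempty (Y t j)]
  [∀ t j, Nonempty (U t j)]

lemma afterAction_update (γ : Profile Y U T) (k : ι) (g : Strategy Y U T k) (t : ℕ)
    (i : Info Y U T t k) (h : Hidden X Y U T t k) (u : U t k) :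
    afterAction (Function.update γ k g) k t i h u = afterAction γ k t i h u := by
  rw [afterAction, afterAction, jointAction_update]

lemma act_join (γ : Profile Y U T) (k : ι) (t : ℕ) (i : Info Y U T t k)
    (h : Hidden X Y U T t k) :
    act γ t (join T t k i h) = afterAction γ k t i h ((γ k t).1 i) := by
  unfold act afterAction
  congr 1
  funext j
  by_cases hj : j = k
  · subst hj
    rw [info_join_self, jointAction_self]
  · rw [info_join_of_ne t k i h ⟨j, hj⟩, jointAction_of_ne _ _ _ _ _ _ hj]

lemma agree_act_afterAction (γ : Profile Y U T) (k : ι) (t : ℕ) (ω : Path X Y U) :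
    Agree t t (act γ t ω) (afterAction γ k t (info T t k ω) (hidden T t k ω)
      ((γ k t).1 (info T t k ω))) := by
  rw [← act_join]
  exact (agree_join t k ω).act γ

lemma act_action_eq_afterAction_action (hT : 1 ≤ T) (γ : Profile Y U T) (k : ι) (t : ℕ)
    (ω : Path X Y U) :
    (act γ t ω).2.2 t = (afterAction γ k t (info T t k ω) (hidden T t k ω)
      ((γ k t).1 (info T t k ω))).2.2 t := by
  rw [← act_join]
  exact (agree_join t k ω).act_action_eq hT γ

lemma info_afterAction (hT : 1 ≤ T) (γ : Profile Y U T) (k : ι) (t : ℕ) (i : Info Y U T t k)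
    (h : Hidden X Y U T t k) (u : U t k) : info T t k (afterAction γ k t i h u) = i := by
  rw [afterAction, ← (agree_setAction t _ _).info_eq hT le_rfl, info_join_self]

lemma info_afterAction_of_ne (hT : 1 ≤ T) (γ : Profile Y U T) (k : ι) (t : ℕ)
    (i : Info Y U T t k) (h : Hidden X Y U T t k) (u : U t k) (j : {j // j ≠ k}) :
    info T t j.1 (afterAction γ k t i h u) = (i.1, h.2 j) := by
  rw [afterAction, ← (agree_setAction t _ _).info_eq hT le_rfl, info_join_of_ne]

lemma hidden_afterAction (γ : Profile Y U T) (k : ι) (t : ℕ) (i : Info Y U T t k)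
    (h : Hidden X Y U T t k) (u : U t k) : hidden T t k (afterAction γ k t i h u) = h := by
  rw [afterAction, ← (agree_setAction t _ _).hidden_eq t.zero_le le_rfl, hidden_join]

lemma afterAction_state (γ : Profile Y U T) (k : ι) (t : ℕ) (i : Info Y U T t k)
    (h : Hidden X Y U T t k) (u : U t k) : (afterAction γ k t i h u).1 t = h.1 :=
  congrArg Prod.fst (hidden_afterAction γ k t i h u)

lemma afterAction_action (γ : Profile Y U T) (k : ι) (t : ℕ) (i : Info Y U T t k)
    (h : Hidden X Y U T t k) (u : U t k) :
    (afterAction γ k t i h u).2.2 t = jointAction γ k t i.1 h.2 u :=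
  setAction_action _ _ _

lemma info_setState_afterAction (hT : 1 ≤ T) (γ : Profile Y U T) (k : ι) (t : ℕ)
    (i : Info Y U T t k) (h : Hidden X Y U T t k) (u : U t k)
    (z : X (t + 1) × ∀ j, Y (t + 1) j) :
    info T (t + 1) k (setState (t + 1) (afterAction γ k t i h u) z) =
      nextInfo γ k t i h u (z.2 k) :=
  info_setState hT t k _ z

lemma obs_setState_afterAction_congr (γ : Profile Y U T) (k : ι) (t : ℕ) {i i' : Info Y U T t k}
    (hi : i.1 = i'.1) (h : Hidden X Y U T t k) (u : U t k) (z : X (t + 1) × ∀ j, Y (t + 1) j)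
    (s : ℕ) {j : ι} (hj : j ≠ k) :
    (setState (t + 1) (afterAction γ k t i h u) z).2.1 s j =
      (setState (t + 1) (afterAction γ k t i' h u) z).2.1 s j := by
  rcases eq_or_ne s (t + 1) with rfl | hs
  · simp [setState]
  · simp [setState, afterAction, setAction, join, fill, hi, hj, hs, Equiv.piSplitAt]

lemma action_afterAction_congr (γ : Profile Y U T) (k : ι) (t : ℕ) {i i' : Info Y U T t k}
    (hi : i.1 = i'.1) (h : Hidden X Y U T t k) (u : U t k) (s : ℕ) {j : ι} (hj : j ≠ k) :
    (afterAction γ k t i h u).2.2 s j = (afterAction γ k t i' h u).2.2 s j := by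
  rcases eq_or_ne s t with rfl | hs
  · simp [afterAction, hi]
  · simp [afterAction, setAction, join, fill, hi, hj, hs, Equiv.piSplitAt]

lemma newData_setState_afterAction_congr (γ : Profile Y U T) (k : ι) (t : ℕ)
    {i i' : Info Y U T t k} (hi : i.1 = i'.1) (h : Hidden X Y U T t k) (u : U t k)
    (z : X (t + 1) × ∀ j, Y (t + 1) j) :
    newData T t k (setState (t + 1) (afterAction γ k t i h u) z) =
      newData T t k (setState (t + 1) (afterAction γ k t i' h u) z) :=
  Prod.ext (by simp [newData, setState]) (funext fun s ↦ funext fun j ↦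
    Prod.ext (obs_setState_afterAction_congr γ k t hi h u z s j.2)
      (action_afterAction_congr γ k t hi h u s j.2))

lemma hidden_setState_afterAction_congr (γ : Profile Y U T) (k : ι) (t : ℕ)
    {i i' : Info Y U T t k} (hi : i.1 = i'.1) (h : Hidden X Y U T t k) (u : U t k)
    (z : X (t + 1) × ∀ j, Y (t + 1) j) :
    hidden T (t + 1) k (setState (t + 1) (afterAction γ k t i h u) z) =
      hidden T (t + 1) k (setState (t + 1) (afterAction γ k t i' h u) z) :=
  Prod.ext (by simp [hidden, setState]) (funext fun j ↦
    Prod.ext (funext fun s ↦ obs_setState_afterAction_congr γ k t hi h u z s j.2)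
      (funext fun s ↦ action_afterAction_congr γ k t hi h u s j.2))

end AfterAction

section Measurability

variable [∀ t, MeasurableSpace (X t)]

section SetData

variable [DecidableEq ι]

lemma measurable_setObs (t : ℕ) (k : ι) :
    Measurable fun p : Path X Y U × Y t k ↦ setObs t k p.1 p.2 := by
  have hobs : Measurable fun p : Path X Y U × Y t k ↦ Function.update (p.1.2.1 t) k p.2 :=
    measurable_update'.comp (by fun_prop :
      Measurable fun p : Path X Y U × Y t k ↦ (p.1.2.1 t, p.2))
  exact .prodMk (by fun_prop) (.prodMk (measurable_update'.comp ((by fun_prop :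
    Measurable fun p : Path X Y U × Y t k ↦ p.1.2.1).prodMk hobs)) (by fun_prop))

lemma measurable_setNewData (t : ℕ) (k : ι) (ω : Path X Y U) :
    Measurable (setNewData (T := T) t k ω) := by
  have hobs : Measurable fun d : NewData Y U T t k ↦ setObs (t + 1) k ω d.1 :=
    (measurable_setObs (t + 1) k).comp (measurable_const.prodMk measurable_fst)
  refine .prodMk measurable_const (.prodMk ?_ ?_)
  all_goals
    refine measurable_pi_iff.mpr fun s ↦ measurable_pi_iff.mpr fun j ↦ ?_
    by_cases h : s + T = t + 1 ∧ j ≠ k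
    · simp only [dif_pos h]; fun_prop
  · simp only [dif_neg h]
    exact (by fun_prop : Measurable fun ω : Path X Y U ↦ ω.2.1 s j).comp hobs
  · simp only [dif_neg h]; exact measurable_const

end SetData

variable [Fintype ι] [DecidableEq ι] [∀ t, Nonempty (X t)] [∀ t j, Nonempty (Y t j)]
  [∀ t j, Nonempty (U t j)]

lemma measurable_afterAction (γ : Profile Y U T) (k : ι) (t : ℕ) :
    Measurable fun p : (Info Y U T t k × U t k) × Hidden X Y U T t k ↦
      afterAction γ k t p.1.1 p.2 p.1.2 :=
  (measurable_setAction t).comp (.prodMk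
    ((measurable_join t k).comp (by fun_prop :
      Measurable fun p : (Info Y U T t k × U t k) × Hidden X Y U T t k ↦ (p.1.1, p.2)))
    ((measurable_jointAction γ k t).comp (by fun_prop :
      Measurable fun p : (Info Y U T t k × U t k) × Hidden X Y U T t k ↦
        (p.1.1.1, p.2.2, p.1.2))))

lemma measurable_afterAction_right (γ : Profile Y U T) (k : ι) (t : ℕ) (i : Info Y U T t k)
    (u : U t k) :
    Measurable fun h : Hidden X Y U T t k ↦ afterAction γ k t i h u :=
  (measurable_afterAction γ k t).comp (measurable_prodMk_left (x := (i, u)))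

lemma measurable_setState_afterAction (γ : Profile Y U T) (k : ι) (t : ℕ) (i : Info Y U T t k)
    (u : U t k) :
    Measurable fun z : Hidden X Y U T t k × X (t + 1) × ∀ j, Y (t + 1) j ↦
      setState (t + 1) (afterAction γ k t i z.1 u) z.2 :=
  (measurable_setState (t + 1)).comp
    ((measurable_afterAction_right γ k t i u).comp measurable_fst |>.prodMk measurable_snd)

lemma measurable_nextInfo (γ : Profile Y U T) (k : ι) (t : ℕ) (i : Info Y U T t k) (u : U t k) :
    Measurable fun z : Hidden X Y U T t k × X (t + 1) × Y (t + 1) k ↦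
      nextInfo γ k t i z.1 u z.2.2 := by
  have hafter : Measurable fun z : Hidden X Y U T t k × X (t + 1) × Y (t + 1) k ↦
      afterAction γ k t i z.1 u :=
    (measurable_afterAction_right γ k t i u).comp measurable_fst
  exact (measurable_info (t + 1) k).comp
    ((measurable_setObs (t + 1) k).comp (hafter.prodMk (by fun_prop)))

end Measurability

end Actions

section Evolution

variable {ι : Type*} {X : ℕ → Type*} {Y U : ℕ → ι → Type*}
  [∀ t, MeasurableSpace (X t)] [∀ t j, MeasurableSpace (Y t j)] [∀ t j, MeasurableSpace (U t j)]
  {T : ℕ}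

namespace Network

variable (M : Network ι X Y U)

lemma pathCost_self (N : ℕ) (ω : Path X Y U) :
    M.pathCost N N ω = (M.cost N (ω.1 N) (ω.2.2 N) : EReal) := by simp [pathCost]

lemma pathCost_of_lt {N t : ℕ} (h : t < N) (ω : Path X Y U) :
    M.pathCost N t ω = (M.cost t (ω.1 t) (ω.2.2 t) : EReal) + M.pathCost N (t + 1) ω := by
  rw [pathCost, pathCost, ← EReal.coe_add, ← Finset.add_sum_Ioc_eq_sum_Icc h.le,
    ← Finset.Icc_add_one_left_eq_Ioc]

lemma cost_isLowerBounded (t : ℕ) :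
    IsLowerBounded fun p : X t × (∀ j, U t j) ↦ (M.cost t p.1 p.2 : EReal) := by
  obtain ⟨c, hc⟩ := M.cost_bddBelow t
  exact ⟨measurable_coe_real_ereal.comp (M.measurable_cost t), c,
    fun p ↦ EReal.coe_le_coe_iff.mpr (hc p.1 p.2)⟩

lemma pathCost_isLowerBounded (N t : ℕ) : IsLowerBounded (M.pathCost N t) := by
  choose c hc using M.cost_bddBelow
  refine ⟨measurable_coe_real_ereal.comp (Finset.measurable_sum _ fun s _ ↦ ?_),
    ∑ s ∈ Finset.Icc t N, c s,
    fun ω ↦ EReal.coe_le_coe_iff.mpr (Finset.sum_le_sum fun s _ ↦ hc s _ _)⟩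
  exact (M.measurable_cost s).comp
    (by fun_prop : Measurable fun ω : Path X Y U ↦ (ω.1 s, ω.2.2 s))

variable [Fintype ι]

/-- Law of the state and of the observations at time `t + 1` given the state and the actions at
time `t`. -/
def noise (t : ℕ) : Kernel (X t × ∀ j, U t j) (X (t + 1) × ∀ j, Y (t + 1) j) :=
  M.S t ⊗ₖ (piKernel (M.Q t)).comap (fun p ↦ (p.2, p.1.2)) (by fun_prop)

instance (t : ℕ) : IsMarkovKernel (M.noise t) := by unfold noise; infer_instance

variable [DecidableEq ι] [∀ t, Nonempty (X t)] [∀ t j, Nonempty (Y t j)]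
  [∀ t j, Nonempty (U t j)]

lemma advance_apply (t : ℕ) (ω : Path X Y U) :
    M.advance t ω = (M.noise t (ω.1 t, ω.2.2 t)).map (setState (t + 1) ω) := by
  refine Measure.ext_of_lintegral _ fun f hf ↦ ?_
  have hfs : Measurable fun p : Path X Y U × (X (t + 1) × ∀ j, Y (t + 1) j) ↦
      f (setState (t + 1) p.1 p.2) := hf.comp (measurable_setState (t + 1))
  have hfω : Measurable fun z ↦ f (setState (t + 1) ω z) := hfs.comp measurable_prodMk_left
  rw [lintegral_map hf (Measurable.of_uncurry_left (measurable_setState (t + 1))), advance,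
    Kernel.lintegral_map _ (measurable_setState (t + 1)) _ hf, Kernel.prod_apply,
    Kernel.id_apply, lintegral_prod _ hfs.aemeasurable,
    lintegral_dirac' _ hfs.lintegral_prod_right', noise, Kernel.lintegral_compProd _ _ _ hfω,
    Kernel.lintegral_compProd _ _ _ hfω]
  rfl

lemma map_advance_congr {ω ω' : Path X Y U} {t₀ : ℕ} (t : ℕ) (hω : Agree t₀ t ω ω')
    (ht : t₀ ≤ t) (hu : ω.2.2 t = ω'.2.2 t) {β : Type*} [MeasurableSpace β] {f : Path X Y U → β}
    (hf : Measurable f) (hcongr : ∀ ω ω', Agree t₀ (t + 1) ω ω' → f ω = f ω') :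
    (M.advance t ω).map f = (M.advance t ω').map f := by
  rw [advance_apply, advance_apply,
    Measure.map_map hf (Measurable.of_uncurry_left (measurable_setState (t + 1))),
    Measure.map_map hf (Measurable.of_uncurry_left (measurable_setState (t + 1))),
    hω.1 t ht le_rfl, hu]
  congr 1
  exact funext fun z ↦ hcongr _ _ (hω.setState hu z)

lemma run_zero_apply (γ : Profile Y U T) (t : ℕ) (ω : Path X Y U) :
    M.run γ t 0 ω = Measure.dirac (act γ t ω) := by
  rw [run, Kernel.deterministic_apply]

lemma run_succ_apply (γ : Profile Y U T) (t m : ℕ) (ω : Path X Y U) :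
    M.run γ t (m + 1) ω = M.run γ (t + 1) m ∘ₘ M.advance t (act γ t ω) := by
  rw [run, Kernel.comp_apply, Kernel.comp_apply, Kernel.deterministic_apply,
    Measure.dirac_bind (Kernel.measurable _)]

lemma run_congr {γ γ' : Profile Y U T} {t : ℕ} (h : ∀ s ≥ t, ∀ j, γ j s = γ' j s) (m : ℕ) :
    M.run γ t m = M.run γ' t m := by
  have hact : (act γ t : Path X Y U → Path X Y U) = act γ' t := by
    funext ω
    simp only [act, h t le_rfl]
  induction m generalizing t with
  | zero => exact Kernel.ext fun ω ↦ by rw [run_zero_apply, run_zero_apply, hact]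
  | succ m ih =>
    refine Kernel.ext fun ω ↦ ?_
    rw [run_succ_apply, run_succ_apply, hact, ih (fun s hs ↦ h s (by omega))]
    funext ω
    simp only [act, h (t + 1) (by omega)]

lemma ae_run_of_agree (γ : Profile Y U T) {t m : ℕ} {ω : Path X Y U} {p : Path X Y U → Prop}
    (hp : MeasurableSet {ω' | p ω'})
    (h : ∀ ω', Agree 0 t ω ω' → ω'.2.2 t = (act γ t ω).2.2 t → p ω') :
    ∀ᵐ ω' ∂M.run γ t m ω, p ω' := by
  induction m generalizing t ω with
  | zero =>
    rw [run_zero_apply, ae_dirac_iff hp]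
    exact h _ (agree_act γ t ω) rfl
  | succ m ih =>
    rw [run_succ_apply, advance_apply]
    have hset : MeasurableSet {ω₁ | ∀ᵐ ω' ∂M.run γ (t + 1) m ω₁, p ω'} :=
      measurableSet_eq_fun (Kernel.measurable_coe _ hp.compl) measurable_const
    refine Measure.ae_comp_of_ae_ae hp ((ae_map_iff
      (Measurable.of_uncurry_left (measurable_setState (t + 1))).aemeasurable hset).mpr
      (ae_of_all _ fun z ↦ ih fun ω' hω' _ ↦ ?_))
    refine h ω' (((agree_act γ t ω).trans (agree_setState t _ z)).trans
      (hω'.mono le_rfl (Nat.le_succ t))) ?_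
    exact (hω'.2.2 t (Nat.lt_succ_self t)).symm

/-- Law of the trajectory up to the observations at time `t`. -/
def preLaw (γ : Profile Y U T) : ℕ → Measure (Path X Y U)
  | 0 => M.initLaw
  | t + 1 => M.advance t ∘ₘ (preLaw γ t).map (act γ t)

instance (γ : Profile Y U T) (t : ℕ) : IsProbabilityMeasure (M.preLaw γ t) := by
  induction t with
  | zero => unfold preLaw; infer_instance
  | succ t _ =>
    have := Measure.isProbabilityMeasure_map (μ := M.preLaw γ t)
      (measurable_act γ t).aemeasurable
    unfold preLaw
    infer_instance

lemma law_add (γ : Profile Y U T) (t m : ℕ) :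
    M.law (t + m) γ = M.run γ t m ∘ₘ M.preLaw γ t := by
  induction t generalizing m with
  | zero => rw [zero_add]; rfl
  | succ t ih =>
    rw [show t + 1 + m = t + (m + 1) by omega, ih, run, preLaw,
      ← Measure.deterministic_comp_eq_map (measurable_act γ t), Measure.comp_assoc,
      Measure.comp_assoc, Kernel.comp_assoc]

lemma law_eq_run_comp_preLaw (γ : Profile Y U T) {t N : ℕ} (h : t ≤ N) :
    M.law N γ = M.run γ t (N - t) ∘ₘ M.preLaw γ t := by
  rw [← law_add, Nat.add_sub_cancel' h]

lemma map_law (γ : Profile Y U T) {t N : ℕ} (h : t ≤ N) {β : Type*} [MeasurableSpace β]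
    {f : Path X Y U → β} (hf : Measurable f) (hcongr : ∀ ω ω', Agree 0 t ω ω' → f ω = f ω') :
    (M.law N γ).map f = (M.preLaw γ t).map f := by
  refine Measure.ext_of_lintegral _ fun φ hφ ↦ ?_
  have hφf : Measurable fun ω ↦ φ (f ω) := hφ.comp hf
  rw [lintegral_map hφ hf, lintegral_map hφ hf, M.law_eq_run_comp_preLaw γ h,
    Measure.lintegral_bind (Kernel.aemeasurable _) hφf.aemeasurable]
  refine lintegral_congr fun ω ↦ ?_
  have hconst : ∀ᵐ ω' ∂M.run γ t (N - t) ω, φ (f ω') = φ (f ω) :=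
    M.ae_run_of_agree γ (measurableSet_eq_fun hφf measurable_const)
      fun ω' hω' _ ↦ by rw [hcongr ω ω' hω']
  rw [lintegral_congr_ae hconst, lintegral_const, measure_univ, mul_one]

/-- Expected cost at the times `t, …, N` when the profile `γ` is used from time `t` on, given the
trajectory up to time `t`. -/
def pathCostToGo (N : ℕ) (γ : Profile Y U T) (t : ℕ) (ω : Path X Y U) : EReal :=
  eint (M.run γ t (N - t) ω) (M.pathCost N t)

lemma pathCostToGo_isLowerBounded (N : ℕ) (γ : Profile Y U T) (t : ℕ) :
    IsLowerBounded (M.pathCostToGo N γ t) :=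
  IsLowerBounded.eint_kernel (f := fun p : Path X Y U × Path X Y U ↦ M.pathCost N t p.2)
    ((M.pathCost_isLowerBounded N t).comp measurable_snd)

lemma pathCostToGo_self (N : ℕ) (γ : Profile Y U T) (ω : Path X Y U) :
    M.pathCostToGo N γ N ω = (M.cost N (ω.1 N) ((act γ N ω).2.2 N) : EReal) := by
  rw [pathCostToGo, Nat.sub_self, run_zero_apply,
    eint_dirac _ (M.pathCost_isLowerBounded N N).measurable, pathCost_self]
  rfl

lemma pathCostToGo_of_lt {N : ℕ} (γ : Profile Y U T) {t : ℕ} (ht : t < N) (ω : Path X Y U) :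
    M.pathCostToGo N γ t ω = (M.cost t (ω.1 t) ((act γ t ω).2.2 t) : EReal) +
      eint (M.advance t (act γ t ω)) (M.pathCostToGo N γ (t + 1)) := by
  set c : EReal := (M.cost t (ω.1 t) ((act γ t ω).2.2 t) : EReal)
  have hcost : M.pathCost N t =ᵐ[M.run γ t (N - t) ω] fun ω' ↦ c + M.pathCost N (t + 1) ω' := by
    refine M.ae_run_of_agree γ (measurableSet_eq_fun (M.pathCost_isLowerBounded N t).measurable
      (measurable_const.add (M.pathCost_isLowerBounded N (t + 1)).measurable)) fun ω' hω' hu ↦ ?_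
    rw [M.pathCost_of_lt ht, hu, ← hω'.1 t (Nat.zero_le _) le_rfl]
  have hc : IsLowerBounded fun _ : Path X Y U ↦ c := ⟨measurable_const, _, fun _ ↦ le_rfl⟩
  rw [pathCostToGo, eint_congr_ae hcost, eint_add hc (M.pathCost_isLowerBounded N (t + 1)),
    eint_const, show N - t = N - (t + 1) + 1 by omega, run_succ_apply,
    eint_comp (M.pathCost_isLowerBounded N (t + 1))]
  rfl

lemma pathCostToGo_congr (hT : 1 ≤ T) (γ : Profile Y U T) {t N : ℕ} (ht : t ≤ N)
    {ω ω' : Path X Y U} (h : Agree t t ω ω') :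
    M.pathCostToGo N γ t ω = M.pathCostToGo N γ t ω' := by
  induction ht using Nat.decreasingInduction generalizing ω ω' with
  | self =>
    rw [pathCostToGo_self, pathCostToGo_self, h.1 N le_rfl le_rfl, h.act_action_eq hT γ]
  | of_succ t ht ih =>
    have hmeas := (M.pathCostToGo_isLowerBounded N γ (t + 1)).measurable
    have hnext := eint_eq_of_map_eq hmeas (M.map_advance_congr t (h.act γ) le_rfl
      (h.act_action_eq hT γ) hmeas fun _ _ hagree ↦ ih (hagree.mono t.le_succ le_rfl))
    rw [M.pathCostToGo_of_lt γ ht, M.pathCostToGo_of_lt γ ht, h.1 t le_rfl le_rfl,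
      h.act_action_eq hT γ]
    exact congrArg _ hnext

lemma eint_law_indicator_pathCost (hT : 1 ≤ T) (γ : Profile Y U T) {t N : ℕ} (ht : t ≤ N)
    {s : Set (Path X Y U)} (hs : MeasurableSet s)
    (hcongr : ∀ ω ω', Agree 0 t ω ω' → (ω ∈ s ↔ ω' ∈ s)) :
    eint (M.law N γ) (s.indicator (M.pathCost N t)) =
      eint (M.law N γ) (s.indicator (M.pathCostToGo N γ t)) := by
  have hF := ((M.pathCostToGo_isLowerBounded N γ t).indicator hs).measurable
  have hF_congr (ω ω' : Path X Y U) (h : Agree 0 t ω ω') :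
      s.indicator (M.pathCostToGo N γ t) ω = s.indicator (M.pathCostToGo N γ t) ω' := by
    classical
    exact if_congr (hcongr ω ω' h) (M.pathCostToGo_congr hT γ ht (h.mono t.zero_le le_rfl)) rfl
  have hrun (ω : Path X Y U) : eint (M.run γ t (N - t) ω) (s.indicator (M.pathCost N t)) =
      s.indicator (M.pathCostToGo N γ t) ω := by
    by_cases hω : ω ∈ s
    · rw [Set.indicator_of_mem hω]
      refine eint_congr_ae (M.ae_run_of_agree γ (measurableSet_eq_fun
        ((M.pathCost_isLowerBounded N t).indicator hs).measurable
        (M.pathCost_isLowerBounded N t).measurable) fun ω' h _ ↦ ?_)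
      exact Set.indicator_of_mem ((hcongr ω ω' h).mp hω) _
    · rw [Set.indicator_of_notMem hω, ← eint_zero (μ := M.run γ t (N - t) ω)]
      refine eint_congr_ae (M.ae_run_of_agree γ (measurableSet_eq_fun
        ((M.pathCost_isLowerBounded N t).indicator hs).measurable measurable_const)
        fun ω' h _ ↦ ?_)
      exact Set.indicator_of_notMem (mt (hcongr ω ω' h).mpr hω) _
  rw [M.law_eq_run_comp_preLaw γ ht, eint_comp ((M.pathCost_isLowerBounded N t).indicator hs),
    ← M.law_eq_run_comp_preLaw γ ht]
  simp only [hrun]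
  exact (eint_eq_of_map_eq hF (M.map_law γ ht hF hF_congr)).symm

end Network

end Evolution

section Disintegration

variable {α β γ Ω : Type*} [MeasurableSpace α] [MeasurableSpace β] [MeasurableSpace γ]
  [MeasurableSpace Ω] {f : Ω → β} {g : Ω → γ}

lemma map_prodMk_comp_eq_compProd {κ : Kernel α Ω} {μ : Measure α} {η : Kernel β γ} [SFinite μ]
    [IsSFiniteKernel κ] [IsSFiniteKernel η] (hf : Measurable f) (hg : Measurable g)
    (h : ∀ a, (κ a).map (fun ω ↦ (f ω, g ω)) = (κ a).map f ⊗ₘ η) :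
    (κ ∘ₘ μ).map (fun ω ↦ (f ω, g ω)) = (κ ∘ₘ μ).map f ⊗ₘ η := by
  have hκ : κ.map (fun ω ↦ (f ω, g ω)) = (Kernel.id ×ₖ η) ∘ₖ κ.map f := by
    ext1 a
    rw [Kernel.map_apply _ (hf.prodMk hg), h, Measure.compProd_eq_comp_prod, Kernel.comp_apply,
      Kernel.map_apply _ hf]
  rw [Measure.map_comp _ _ (hf.prodMk hg), hκ, ← Measure.comp_assoc, ← Measure.map_comp _ _ hf,
    Measure.compProd_eq_comp_prod]

lemma map_prodMk_eq_compProd_of_factor {ν : Measure Ω} {κ : Kernel β γ} {η : Kernel α γ}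
    [SFinite ν] [IsSFiniteKernel κ] [IsSFiniteKernel η] (hf : Measurable f) (hg : Measurable g)
    (h : ν.map (fun ω ↦ (f ω, g ω)) = ν.map f ⊗ₘ κ) {Φ : β → α} (hΦ : Measurable Φ)
    (hη : ∀ b, κ b = η (Φ b)) :
    ν.map (fun ω ↦ (Φ (f ω), g ω)) = ν.map (fun ω ↦ Φ (f ω)) ⊗ₘ η := by
  have hfac : κ = η.comap Φ hΦ := Kernel.ext hη
  refine Measure.ext_of_lintegral _ fun F hF ↦ ?_
  have hFΦ : Measurable fun p : β × γ ↦ F (Φ p.1, p.2) := by fun_prop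
  calc ∫⁻ p, F p ∂ν.map (fun ω ↦ (Φ (f ω), g ω))
      = ∫⁻ p, F (Φ p.1, p.2) ∂ν.map (fun ω ↦ (f ω, g ω)) := by
        rw [lintegral_map hF (by fun_prop), lintegral_map hFΦ (hf.prodMk hg)]
    _ = ∫⁻ b, ∫⁻ c, F (Φ b, c) ∂η (Φ b) ∂ν.map f := by
        rw [h, Measure.lintegral_compProd hFΦ, hfac]
        rfl
    _ = ∫⁻ p, F p ∂ν.map (fun ω ↦ Φ (f ω)) ⊗ₘ η := by
        have hη' : Measurable fun a ↦ ∫⁻ c, F (a, c) ∂η a := hF.lintegral_kernel_prod_right'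
        have hηΦ : Measurable fun b ↦ ∫⁻ c, F (Φ b, c) ∂η (Φ b) := hη'.comp hΦ
        rw [Measure.lintegral_compProd hF, lintegral_map hη' (by fun_prop),
          lintegral_map hηΦ hf]

end Disintegration

section Transition

variable {ι : Type*} [Fintype ι] [DecidableEq ι] {X : ℕ → Type*} {Y U : ℕ → ι → Type*}
  [∀ t, MeasurableSpace (X t)] [∀ t j, MeasurableSpace (Y t j)] [∀ t j, MeasurableSpace (U t j)]
  [∀ t j, Nonempty (Y t j)] [∀ t j, Nonempty (U t j)] {T : ℕ}

namespace Network

variable (M : Network ι X Y U)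

instance (γ : Profile Y U T) (t : ℕ) (k : ι) : IsMarkovKernel (M.transition γ t k) := by
  unfold transition; infer_instance

lemma transition_update (γ : Profile Y U T) (t : ℕ) (k : ι) (g : Strategy Y U T k) :
    M.transition (Function.update γ k g) t k = M.transition γ t k := by
  simp only [transition, jointAction_update]

/-- The law of `((X_t, Λ_t^{-k}), X_{t+1}, Y_{t+1})` as a function of `(ξ, δ, u)`: the transition
law `Network.transition` with the observations of all agents instead of those of agent `k`. -/
def jointTransition (γ : Profile Y U T) (t : ℕ) (k : ι) :
    Kernel (Belief X Y U T t k) (Hidden X Y U T t k × X (t + 1) × ∀ j, Y (t + 1) j) :=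
  beliefKernel t k ⊗ₖ (M.noise t).comap
    (fun p : Belief X Y U T t k × Hidden X Y U T t k ↦
      (p.2.1, jointAction γ k t p.1.2.1 p.2.2 p.1.2.2))
    (.prodMk (by fun_prop) ((measurable_jointAction γ k t).comp (by fun_prop :
      Measurable fun p : Belief X Y U T t k × Hidden X Y U T t k ↦ (p.1.2.1, p.2.2, p.1.2.2))))

instance (γ : Profile Y U T) (t : ℕ) (k : ι) : IsMarkovKernel (M.jointTransition γ t k) := by
  unfold jointTransition; infer_instance

lemma transition_apply (γ : Profile Y U T) (t : ℕ) (k : ι) (b : Belief X Y U T t k) :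
    M.transition γ t k b = (M.jointTransition γ t k b).map fun z ↦ (z.1, z.2.1, z.2.2 k) := by
  refine Measure.ext_of_lintegral _ fun φ hφ ↦ ?_
  rw [lintegral_map hφ (by fun_prop), transition, jointTransition,
    Kernel.lintegral_compProd _ _ _ hφ, Kernel.lintegral_compProd _ _ _ (by fun_prop)]
  refine lintegral_congr fun h ↦ ?_
  have hφh : Measurable fun p ↦ φ (h, p) := hφ.comp measurable_prodMk_left
  rw [Kernel.comap_apply, noise, Kernel.lintegral_compProd _ _ _ hφh,
    Kernel.lintegral_compProd _ _ _ (by fun_prop)]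
  exact lintegral_congr fun x ↦ ((measurePreserving_eval (fun j ↦ M.Q t j _) k).lintegral_comp
    (hφh.comp measurable_prodMk_left)).symm

variable [∀ t, Nonempty (X t)]

lemma nextLaw_update (γ : Profile Y U T) (t : ℕ) (k : ι) (g : Strategy Y U T k) :
    M.nextLaw (Function.update γ k g) t k = M.nextLaw γ t k := by
  simp only [nextLaw, jointAction_update]

lemma advance_comp_map_afterAction (γ : Profile Y U T) (k : ι) (t : ℕ)
    (ξ : ProbabilityMeasure (Hidden X Y U T t k)) (i : Info Y U T t k) (u : U t k) :
    M.advance t ∘ₘ (ξ : Measure _).map (fun h ↦ afterAction γ k t i h u) =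
      (M.jointTransition γ t k (ξ, i.1, u)).map
        fun z ↦ setState (t + 1) (afterAction γ k t i z.1 u) z.2 := by
  have hstep := measurable_setState_afterAction (X := X) γ k t i u
  have hact : Measurable fun h : Hidden X Y U T t k ↦ afterAction γ k t i h u :=
    measurable_afterAction_right γ k t i u
  refine Measure.ext_of_lintegral _ fun f hf ↦ ?_
  rw [Measure.lintegral_bind (Kernel.aemeasurable _) hf.aemeasurable,
    lintegral_map hf.lintegral_kernel hact, lintegral_map hf hstep, jointTransition,
    Kernel.lintegral_compProd _ _ _ (by fun_prop)]
  refine lintegral_congr fun h ↦ ?_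
  rw [advance_apply, lintegral_map hf (.of_uncurry_left (measurable_setState (t + 1))),
    afterAction_state, afterAction_action]
  rfl

lemma map_advance_comp_map_afterAction (γ : Profile Y U T) (k : ι) (t : ℕ)
    (ξ : ProbabilityMeasure (Hidden X Y U T t k)) (i : Info Y U T t k) (u : U t k) {β : Type*}
    [MeasurableSpace β] {f : Path X Y U → β} (hf : Measurable f) :
    (M.advance t ∘ₘ (ξ : Measure _).map (fun h ↦ afterAction γ k t i h u)).map f =
      (M.jointTransition γ t k (ξ, i.1, u)).map
        fun z ↦ f (setState (t + 1) (afterAction γ k t i z.1 u) z.2) := by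
  rw [advance_comp_map_afterAction,
    Measure.map_map hf (measurable_setState_afterAction γ k t i u)]
  rfl

lemma nextLaw_apply (γ : Profile Y U T) (t : ℕ) (k : ι) (b : Belief X Y U T t k) :
    M.nextLaw γ t k b = M.advance t ∘ₘ (b.1 : Measure _).map
      fun h ↦ afterAction γ k t (b.2.1, Classical.arbitrary _) h b.2.2 := by
  rw [nextLaw, Kernel.comp_apply, Kernel.map_apply _ (measurable_nextLaw_aux γ t k),
    Kernel.prod_apply, Kernel.id_apply, Measure.dirac_prod,
    Measure.map_map (measurable_nextLaw_aux γ t k) measurable_prodMk_left]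
  rfl

end Network

end Transition

section Posterior

variable {ι : Type*} [Fintype ι] [DecidableEq ι] {X : ℕ → Type*} {Y U : ℕ → ι → Type*}
  [∀ t, MeasurableSpace (X t)] [∀ t j, MeasurableSpace (Y t j)] [∀ t j, MeasurableSpace (U t j)]
  [∀ t, Nonempty (X t)] [∀ t j, Nonempty (Y t j)] [∀ t j, Nonempty (U t j)]
  [∀ t, StandardBorelSpace (X t)] [∀ t j, StandardBorelSpace (Y t j)]
  [∀ t j, StandardBorelSpace (U t j)] {T : ℕ}

namespace Network

variable (M : Network ι X Y U)

instance (γ : Profile Y U T) (k : ι) (t : ℕ) : IsMarkovKernel (M.posteriorKernel γ k t) :=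
  ⟨fun i ↦ (M.posterior γ k t i).2⟩

instance (γ : Profile Y U T) (k : ι) (t : ℕ) : IsMarkovKernel (M.infoTransition γ k t) := by
  unfold infoTransition; infer_instance

lemma filter_update (γ : Profile Y U T) (t : ℕ) (k : ι) (g : Strategy Y U T k) :
    M.filter (Function.update γ k g) t k = M.filter γ t k := by
  unfold filter
  simp only [nextLaw_update]

lemma posterior_succ (γ : Profile Y U T) (k : ι) (t : ℕ) (i : Info Y U T (t + 1) k) :
    M.posterior γ k (t + 1) i = ⟨M.filter γ t k
      ((M.posterior γ k t (prevInfo X t k i), (prevInfo X t k i).1, prevAction X t k i),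
        lastData X t k i), inferInstance⟩ := rfl

lemma posterior_update (γ : Profile Y U T) (k : ι) (g : Strategy Y U T k) (t : ℕ) :
    M.posterior (Function.update γ k g) k t = M.posterior γ k t := by
  induction t with
  | zero => rfl
  | succ t ih =>
    funext i
    simp only [posterior_succ, filter_update, ih]
    rfl

lemma posteriorKernel_update (γ : Profile Y U T) (k : ι) (g : Strategy Y U T k) (t : ℕ) :
    M.posteriorKernel (Function.update γ k g) k t = M.posteriorKernel γ k t := by
  simp only [posteriorKernel, posterior_update]

lemma infoTransition_update (γ : Profile Y U T) (k : ι) (g : Strategy Y U T k) (t : ℕ) :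
    M.infoTransition (Function.update γ k g) k t = M.infoTransition γ k t := by
  simp only [infoTransition, posterior_update, transition_update]

lemma isConditionallyMarkov (γ : Profile Y U T) (k : ι) : M.IsConditionallyMarkov γ k :=
  fun t ↦ ⟨fun p ↦ ⟨M.filter γ t k p, inferInstance⟩,
    Measurable.subtype_mk (M.filter γ t k).measurable, fun _ ↦ rfl⟩

/-- Law of the trajectory up to the observations at time `t + 1`, given `I_t^k = i` and
`U_t^k = u`, when the other agents follow `γ^{-k}`. -/
def stepKernel (γ : Profile Y U T) (k : ι) (t : ℕ) :
    Kernel (Info Y U T t k × U t k) (Path X Y U) :=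
  M.advance t ∘ₖ ((Kernel.id ×ₖ (M.posteriorKernel γ k t).comap Prod.fst measurable_fst).map
    fun p ↦ afterAction γ k t p.1.1 p.2 p.1.2)

instance (γ : Profile Y U T) (k : ι) (t : ℕ) : IsMarkovKernel (M.stepKernel γ k t) := by
  have := Kernel.IsMarkovKernel.map
    (Kernel.id ×ₖ (M.posteriorKernel γ k t).comap Prod.fst measurable_fst)
    (measurable_afterAction γ k t)
  unfold stepKernel
  infer_instance

variable (γ : Profile Y U T) (k : ι) (t : ℕ)

lemma stepKernel_apply (i : Info Y U T t k) (u : U t k) :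
    M.stepKernel γ k t (i, u) = M.advance t ∘ₘ (M.posteriorKernel γ k t i).map
      fun h ↦ afterAction γ k t i h u := by
  rw [stepKernel, Kernel.comp_apply, Kernel.map_apply _ (measurable_afterAction γ k t),
    Kernel.prod_apply, Kernel.id_apply, Measure.dirac_prod,
    Measure.map_map (measurable_afterAction γ k t) measurable_prodMk_left]
  rfl

lemma map_stepKernel (i : Info Y U T t k) (u : U t k) {β : Type*} [MeasurableSpace β]
    {f : Path X Y U → β} (hf : Measurable f) :
    (M.stepKernel γ k t (i, u)).map f =
      (M.jointTransition γ t k (M.posterior γ k t i, i.1, u)).map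
        fun z ↦ f (setState (t + 1) (afterAction γ k t i z.1 u) z.2) := by
  rw [stepKernel_apply]
  exact M.map_advance_comp_map_afterAction γ k t _ i u hf

lemma map_info_stepKernel (hT : 1 ≤ T) (i : Info Y U T t k) (u : U t k) :
    (M.stepKernel γ k t (i, u)).map (info T (t + 1) k) =
      (M.infoTransition γ k t (i, u)).map fun z ↦ nextInfo γ k t i z.1 u z.2.2 := by
  rw [M.map_stepKernel γ k t i u (measurable_info (t + 1) k), infoTransition, Kernel.comap_apply,
    transition_apply, Measure.map_map (measurable_nextInfo γ k t i u) (by fun_prop)]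
  simp only [info_setState_afterAction hT]
  rfl

lemma map_newData_hidden_stepKernel (i : Info Y U T t k) (u : U t k) :
    (M.stepKernel γ k t (i, u)).map (fun ω ↦ (newData T t k ω, hidden T (t + 1) k ω)) =
      (M.nextLaw γ t k (M.posterior γ k t i, i.1, u)).map
        fun ω ↦ (newData T t k ω, hidden T (t + 1) k ω) := by
  have hm : Measurable fun ω : Path X Y U ↦ (newData T t k ω, hidden T (t + 1) k ω) :=
    (measurable_newData t k).prodMk (measurable_hidden _ k)
  rw [M.map_stepKernel γ k t i u hm, nextLaw_apply, M.map_advance_comp_map_afterAction γ k t _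
    (i.1, Classical.arbitrary _) u hm]
  congr 1
  funext z
  exact Prod.ext
    (newData_setState_afterAction_congr γ k t (i := i) (i' := (i.1, Classical.arbitrary _))
      rfl z.1 u z.2)
    (hidden_setState_afterAction_congr γ k t (i := i) (i' := (i.1, Classical.arbitrary _))
      rfl z.1 u z.2)

lemma map_newData_hidden_nextLaw (b : Belief X Y U T t k) :
    (M.nextLaw γ t k b).map (fun ω ↦ (newData T t k ω, hidden T (t + 1) k ω)) =
      (M.nextLaw γ t k b).map (newData T t k) ⊗ₘ
        (M.filter γ t k).comap (Prod.mk b) measurable_prodMk_left := by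
  have hm : Measurable fun ω : Path X Y U ↦ (newData T t k ω, hidden T (t + 1) k ω) :=
    (measurable_newData t k).prodMk (measurable_hidden _ k)
  set κ := (M.nextLaw γ t k).map fun ω ↦ (newData T t k ω, hidden T (t + 1) k ω) with hκ
  have : IsMarkovKernel κ := Kernel.IsMarkovKernel.map _ hm
  have hfst : κ.fst b = (M.nextLaw γ t k b).map (newData T t k) := by
    rw [Kernel.fst_apply, hκ, Kernel.map_apply _ hm, Measure.map_map measurable_fst hm]
    rfl
  rw [← Kernel.map_apply _ hm, ← hκ, ← hfst]
  conv_lhs => rw [← κ.disintegrate κ.condKernel]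
  exact Kernel.compProd_apply_eq_compProd_sectR _ _ b

lemma filter_eq_posteriorKernel_setNewData (hT : 1 ≤ T) {i : Info Y U T t k} {u : U t k}
    {ω₀ : Path X Y U} (hi : info T t k ω₀ = i) (hu : ω₀.2.2 t k = u) (d : NewData Y U T t k) :
    M.filter γ t k ((M.posterior γ k t i, i.1, u), d) =
      M.posteriorKernel γ k (t + 1) (info T (t + 1) k (setNewData t k ω₀ d)) := by
  change _ = (M.posterior γ k (t + 1) _ : Measure (Hidden X Y U T (t + 1) k))
  rw [posterior_succ, prevInfo_info, prevAction_info, lastData_info, info_setNewData hT, hi,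
    action_setNewData, hu, newData_setNewData]
  rfl

lemma map_info_hidden_stepKernel (hT : 1 ≤ T) (p : Info Y U T t k × U t k) :
    (M.stepKernel γ k t p).map (fun ω ↦ (info T (t + 1) k ω, hidden T (t + 1) k ω)) =
      (M.stepKernel γ k t p).map (info T (t + 1) k) ⊗ₘ M.posteriorKernel γ k (t + 1) := by
  obtain ⟨i, u⟩ := p
  have hnew : Measurable (newData T t k : Path X Y U → _) := measurable_newData t k
  have hinfo : Measurable (info T (t + 1) k : Path X Y U → _) := measurable_info (t + 1) k
  have hhid : Measurable (hidden T (t + 1) k : Path X Y U → _) := measurable_hidden (t + 1) k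
  set ω₀ : Path X Y U := afterAction γ k t i (Classical.arbitrary _) u
  have hi : info T t k ω₀ = i := info_afterAction hT γ k t i _ u
  have hu : ω₀.2.2 t k = u := by rw [afterAction_action, jointAction_self]
  set Φ : NewData Y U T t k → Info Y U T (t + 1) k :=
    fun d ↦ info T (t + 1) k (setNewData t k ω₀ d)
  have hΦ : Measurable Φ := hinfo.comp (measurable_setNewData t k ω₀)
  have hstep : (M.stepKernel γ k t (i, u)).map
        (fun ω ↦ (info T (t + 1) k ω, hidden T (t + 1) k ω)) =
      (M.stepKernel γ k t (i, u)).map fun ω ↦ (Φ (newData T t k ω), hidden T (t + 1) k ω) := by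
    rw [M.map_stepKernel γ k t i u (hinfo.prodMk hhid),
      M.map_stepKernel γ k t i u
        (f := fun ω ↦ (Φ (newData T t k ω), hidden T (t + 1) k ω)) ((hΦ.comp hnew).prodMk hhid)]
    congr 1
    funext z
    have hz := agree_setState t (afterAction γ k t i z.1 u) z.2
    refine Prod.ext (info_succ_eq_info_setNewData hT ?_ ?_) rfl
    · rw [← hz.info_eq hT le_rfl, hi, info_afterAction hT]
    · change (afterAction γ k t i z.1 u).2.2 t k = _
      rw [hu, afterAction_action, jointAction_self]
  have hΦinfo : (M.stepKernel γ k t (i, u)).map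
        (fun ω ↦ (info T (t + 1) k ω, hidden T (t + 1) k ω)) =
      (M.nextLaw γ t k (M.posterior γ k t i, i.1, u)).map
        fun ω ↦ (Φ (newData T t k ω), hidden T (t + 1) k ω) := by
    have h := congrArg (Measure.map (Prod.map Φ id)) (M.map_newData_hidden_stepKernel γ k t i u)
    rw [Measure.map_map (by fun_prop) (hnew.prodMk hhid),
      Measure.map_map (by fun_prop) (hnew.prodMk hhid)] at h
    exact hstep.trans h
  have hfst := congrArg Measure.fst hΦinfo
  rw [Measure.fst_map_prodMk hhid, Measure.fst_map_prodMk hhid] at hfst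
  rw [hΦinfo, hfst]
  exact map_prodMk_eq_compProd_of_factor hnew hhid (M.map_newData_hidden_nextLaw γ k t _) hΦ
    fun d ↦ M.filter_eq_posteriorKernel_setNewData γ k t hT hi hu d

lemma map_observed_stepKernel (hT : 1 ≤ T) (p : Info Y U T t k × U t k) :
    (M.stepKernel γ k t p).map (fun ω ↦ ((info T t k ω, ω.2.2 t k),
        (hidden T t k ω, ω.1 (t + 1), ω.2.1 (t + 1) k))) =
      (M.stepKernel γ k t p).map (fun ω ↦ (info T t k ω, ω.2.2 t k)) ⊗ₘ
        M.infoTransition γ k t := by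
  obtain ⟨i, u⟩ := p
  have hobs : Measurable fun ω : Path X Y U ↦ (info T t k ω, ω.2.2 t k) :=
    (measurable_info t k).prodMk (by fun_prop)
  have hnext : Measurable fun ω : Path X Y U ↦
      (hidden T t k ω, ω.1 (t + 1), ω.2.1 (t + 1) k) :=
    (measurable_hidden t k).prodMk (by fun_prop)
  rw [M.map_stepKernel γ k t i u (hobs.prodMk hnext), M.map_stepKernel γ k t i u hobs]
  let σ : Hidden X Y U T t k × X (t + 1) × (∀ j, Y (t + 1) j) → Path X Y U :=
    fun z ↦ setState (t + 1) (afterAction γ k t i z.1 u) z.2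
  have hσ (z) : Agree 0 t (afterAction γ k t i z.1 u) (σ z) := agree_setState t _ z.2
  have hobsσ (z) : (info T t k (σ z), (σ z).2.2 t k) = (i, u) := by
    refine Prod.ext ?_ ?_
    · exact ((hσ z).info_eq hT le_rfl k).symm.trans (info_afterAction hT γ k t i z.1 u)
    · change (afterAction γ k t i z.1 u).2.2 t k = u
      rw [afterAction_action, jointAction_self]
  have hnextσ (z) : (hidden T t k (σ z), (σ z).1 (t + 1), (σ z).2.1 (t + 1) k) =
      (z.1, z.2.1, z.2.2 k) := by
    rw [← (hσ z).hidden_eq t.zero_le le_rfl, hidden_afterAction]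
    simp [σ, setState]
  change Measure.map (fun z ↦ ((info T t k (σ z), (σ z).2.2 t k), _)) _ =
    Measure.map (fun z ↦ (info T t k (σ z), (σ z).2.2 t k)) _ ⊗ₘ _
  simp only [σ, hobsσ, hnextσ, Measure.map_const, measure_univ, one_smul]
  refine Measure.ext_of_lintegral _ fun φ hφ ↦ ?_
  have hφi : Measurable fun z ↦ φ ((i, u), z) := hφ.comp measurable_prodMk_left
  rw [Measure.lintegral_compProd hφ, lintegral_dirac' _ hφ.lintegral_kernel_prod_right',
    infoTransition, Kernel.comap_apply, transition_apply, lintegral_map hφi (by fun_prop)]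
  exact lintegral_map hφ
    (g := fun z : Hidden X Y U T t k × X (t + 1) × ∀ j, Y (t + 1) j ↦
      ((i, u), z.1, z.2.1, z.2.2 k)) (by fun_prop)

lemma map_preLaw_succ (hT : 1 ≤ T) {t : ℕ} (hd : (M.preLaw γ t).map
      (fun ω ↦ (info T t k ω, hidden T t k ω)) =
        (M.preLaw γ t).map (info T t k) ⊗ₘ M.posteriorKernel γ k t)
    {β : Type*} [MeasurableSpace β] {f : Path X Y U → β} (hf : Measurable f)
    (hcongr : ∀ ω ω', Agree t (t + 1) ω ω' → f ω = f ω') :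
    (M.preLaw γ (t + 1)).map f = (M.stepKernel γ k t ∘ₘ
      (M.preLaw γ t).map fun ω ↦ (info T t k ω, (γ k t).1 (info T t k ω))).map f := by
  refine Measure.ext_of_lintegral _ fun φ hφ ↦ ?_
  have hφf : Measurable fun ω ↦ φ (f ω) := hφ.comp hf
  have hinfo : Measurable (info T t k : Path X Y U → _) := measurable_info t k
  have hhid : Measurable (hidden T t k : Path X Y U → _) := measurable_hidden t k
  have hg := (γ k t).2
  set F : Info Y U T t k × Hidden X Y U T t k → ℝ≥0∞ := fun p ↦
    ∫⁻ ω, φ (f ω) ∂M.advance t (afterAction γ k t p.1 p.2 ((γ k t).1 p.1))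
  have hF : Measurable F := hφf.lintegral_kernel.comp ((measurable_afterAction γ k t).comp
    (by fun_prop : Measurable fun p : Info Y U T t k × Hidden X Y U T t k ↦
      ((p.1, (γ k t).1 p.1), p.2)))
  have hact (ω : Path X Y U) :
      ∫⁻ ω', φ (f ω') ∂M.advance t (act γ t ω) = F (info T t k ω, hidden T t k ω) := by
    have h := congrArg (fun ν ↦ ∫⁻ b, φ b ∂ν)
      (M.map_advance_congr t (agree_act_afterAction γ k t ω) le_rfl
        (act_action_eq_afterAction_action hT γ k t ω) hf hcongr)
    simpa only [lintegral_map hφ hf] using h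
  calc ∫⁻ b, φ b ∂(M.preLaw γ (t + 1)).map f
      = ∫⁻ ω, F (info T t k ω, hidden T t k ω) ∂M.preLaw γ t := by
        rw [lintegral_map hφ hf, preLaw, Measure.lintegral_bind (Kernel.aemeasurable _)
          hφf.aemeasurable, lintegral_map hφf.lintegral_kernel (measurable_act γ t)]
        simp only [hact]
    _ = ∫⁻ i, ∫⁻ h, F (i, h) ∂M.posteriorKernel γ k t i ∂(M.preLaw γ t).map (info T t k) := by
        rw [← lintegral_map hF (hinfo.prodMk hhid), hd, Measure.lintegral_compProd hF]
    _ = ∫⁻ i, ∫⁻ ω, φ (f ω) ∂M.stepKernel γ k t (i, (γ k t).1 i)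
          ∂(M.preLaw γ t).map (info T t k) := by
        refine lintegral_congr fun i ↦ ?_
        rw [stepKernel_apply, Measure.lintegral_bind (Kernel.aemeasurable _) hφf.aemeasurable,
          lintegral_map hφf.lintegral_kernel (measurable_afterAction_right γ k t i _)]
    _ = _ := by
        rw [lintegral_map hφ hf, Measure.lintegral_bind (Kernel.aemeasurable _) hφf.aemeasurable,
          lintegral_map hφf.lintegral_kernel (by fun_prop), lintegral_map ?_ hinfo]
        exact hφf.lintegral_kernel.comp (g := fun q ↦ ∫⁻ ω, φ (f ω) ∂M.stepKernel γ k t q)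
          (by fun_prop : Measurable fun i ↦ (i, (γ k t).1 i))

lemma map_info_hidden_preLaw (hT : 1 ≤ T) :
    (M.preLaw γ t).map (fun ω ↦ (info T t k ω, hidden T t k ω)) =
      (M.preLaw γ t).map (info T t k) ⊗ₘ M.posteriorKernel γ k t := by
  induction t with
  | zero => exact (compProd_map_condDistrib (measurable_hidden 0 k).aemeasurable).symm
  | succ t ih =>
    have hinfo : Measurable (info T (t + 1) k : Path X Y U → _) := measurable_info (t + 1) k
    have hhid : Measurable (hidden T (t + 1) k : Path X Y U → _) := measurable_hidden (t + 1) k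
    have hcongr (ω ω' : Path X Y U) (h : Agree t (t + 1) ω ω') := h.info_eq hT le_rfl k
    rw [M.map_preLaw_succ γ k hT ih hinfo hcongr, M.map_preLaw_succ γ k hT ih (hinfo.prodMk hhid)
      fun ω ω' h ↦ Prod.ext (hcongr ω ω' h) (h.hidden_eq t.le_succ le_rfl k)]
    exact map_prodMk_comp_eq_compProd hinfo hhid (M.map_info_hidden_stepKernel γ k t hT)

lemma map_info_hidden_law (hT : 1 ≤ T) {N : ℕ} (ht : t ≤ N) :
    (M.law N γ).map (fun ω ↦ (info T t k ω, hidden T t k ω)) =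
      (M.law N γ).map (info T t k) ⊗ₘ M.posteriorKernel γ k t := by
  have hcongr (ω ω' : Path X Y U) (h : Agree 0 t ω ω') := h.info_eq hT le_rfl k
  rw [M.map_law γ ht (measurable_info t k) hcongr,
    M.map_law γ ht ((measurable_info t k).prodMk (measurable_hidden t k))
      fun ω ω' h ↦ Prod.ext (hcongr ω ω' h) (h.hidden_eq t.zero_le le_rfl k),
    map_info_hidden_preLaw (hT := hT)]

lemma map_observed_law (hT : 1 ≤ T) {N : ℕ} (ht : t < N) :
    (M.law N γ).map (fun ω ↦ ((info T t k ω, ω.2.2 t k),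
        (hidden T t k ω, ω.1 (t + 1), ω.2.1 (t + 1) k))) =
      (M.law N γ).map (fun ω ↦ (info T t k ω, ω.2.2 t k)) ⊗ₘ M.infoTransition γ k t := by
  have hobs : Measurable fun ω : Path X Y U ↦ (info T t k ω, ω.2.2 t k) :=
    (measurable_info t k).prodMk (by fun_prop)
  have hnext : Measurable fun ω : Path X Y U ↦
      (hidden T t k ω, ω.1 (t + 1), ω.2.1 (t + 1) k) :=
    (measurable_hidden t k).prodMk (by fun_prop)
  have hobs_congr (ω ω' : Path X Y U) (h : Agree t (t + 1) ω ω') :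
      (info T t k ω, ω.2.2 t k) = (info T t k ω', ω'.2.2 t k) := by
    rw [h.info_eq hT t.le_succ, h.2.2 t t.lt_succ_self]
  have hnext_congr (ω ω' : Path X Y U) (h : Agree t (t + 1) ω ω') :
      (hidden T t k ω, ω.1 (t + 1), ω.2.1 (t + 1) k) =
        (hidden T t k ω', ω'.1 (t + 1), ω'.2.1 (t + 1) k) := by
    rw [h.hidden_eq le_rfl t.le_succ, h.1 (t + 1) t.le_succ le_rfl, h.2.1 (t + 1) le_rfl]
  have hpair_congr (ω ω' : Path X Y U) (h : Agree t (t + 1) ω ω') :=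
    Prod.ext (x := (_, _)) (y := (_, _)) (hobs_congr ω ω' h) (hnext_congr ω ω' h)
  have hd := M.map_info_hidden_preLaw γ k t hT
  rw [M.map_law γ ht hobs fun ω ω' h ↦ hobs_congr ω ω' (h.mono t.zero_le le_rfl),
    M.map_law γ ht (hobs.prodMk hnext) fun ω ω' h ↦ hpair_congr ω ω' (h.mono t.zero_le le_rfl),
    M.map_preLaw_succ γ k hT hd hobs hobs_congr,
    M.map_preLaw_succ γ k hT hd (hobs.prodMk hnext) hpair_congr]
  exact map_prodMk_comp_eq_compProd hobs hnext (M.map_observed_stepKernel γ k t hT)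

lemma condDistrib_hidden (hT : 1 ≤ T) {N : ℕ} (ht : t ≤ N) :
    condDistrib (hidden T t k) (info T t k) (M.law N γ) =ᵐ[(M.law N γ).map (info T t k)]
      M.posteriorKernel γ k t :=
  condDistrib_ae_eq_of_measure_eq_compProd _ (measurable_hidden t k).aemeasurable
    (M.map_info_hidden_law γ k t hT ht)

lemma condDistrib_next (hT : 1 ≤ T) {N : ℕ} (ht : t < N) :
    condDistrib (fun ω ↦ (hidden T t k ω, ω.1 (t + 1), ω.2.1 (t + 1) k))
        (fun ω ↦ (info T t k ω, ω.2.2 t k)) (M.law N γ)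
      =ᵐ[(M.law N γ).map fun ω ↦ (info T t k ω, ω.2.2 t k)] M.infoTransition γ k t :=
  condDistrib_ae_eq_of_measure_eq_compProd _
    ((measurable_hidden t k).prodMk (by fun_prop)).aemeasurable
    (M.map_observed_law γ k t hT ht)

lemma condDistrib_hidden_update (g : Strategy Y U T k) (hT : 1 ≤ T) {N : ℕ} (ht : t ≤ N) :
    condDistrib (hidden T t k) (info T t k) (M.law N (Function.update γ k g))
      =ᵐ[(M.law N (Function.update γ k g)).map (info T t k)] M.posteriorKernel γ k t := by
  simpa only [posteriorKernel_update] using M.condDistrib_hidden (Function.update γ k g) k t hT ht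

lemma condDistrib_next_update (g : Strategy Y U T k) (hT : 1 ≤ T) {N : ℕ} (ht : t < N) :
    condDistrib (fun ω ↦ (hidden T t k ω, ω.1 (t + 1), ω.2.1 (t + 1) k))
        (fun ω ↦ (info T t k ω, ω.2.2 t k)) (M.law N (Function.update γ k g))
      =ᵐ[(M.law N (Function.update γ k g)).map fun ω ↦ (info T t k ω, ω.2.2 t k)]
        M.infoTransition γ k t := by
  simpa only [infoTransition_update] using M.condDistrib_next (Function.update γ k g) k t hT ht

end Network

end Posterior

section CostToGo

variable {ι : Type*} [Fintype ι] [DecidableEq ι] {X : ℕ → Type*} {Y U : ℕ → ι → Type*}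
  [∀ t, MeasurableSpace (X t)] [∀ t j, MeasurableSpace (Y t j)] [∀ t j, MeasurableSpace (U t j)]
  [∀ t j, Nonempty (Y t j)] [∀ t j, Nonempty (U t j)] {T : ℕ}

namespace Network

variable (M : Network ι X Y U)

lemma actionCost_isLowerBounded (γ : Profile Y U T) (k : ι) (t : ℕ) (i : Info Y U T t k)
    (u : U t k) : IsLowerBounded (M.actionCost γ k t i u) :=
  (M.cost_isLowerBounded t).comp (measurable_fst.prodMk
    ((measurable_jointAction γ k t).comp (by fun_prop :
      Measurable fun h : Hidden X Y U T t k ↦ (i.1, h.2, u))))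

variable [∀ t, Nonempty (X t)]

section ActionEq

variable [∀ t j, StandardBorelSpace (U t j)]

lemma measurableSet_action_eq (γ : Profile Y U T) (s : ℕ) (j : ι) :
    MeasurableSet {ω : Path X Y U | ω.2.2 s j = (γ j s).1 (info T s j ω)} :=
  measurableSet_eq_fun (by fun_prop) ((γ j s).2.comp (measurable_info s j))

lemma ae_law_action_eq (hT : 1 ≤ T) (γ : Profile Y U T) {s N : ℕ} (hs : s ≤ N) (j : ι) :
    ∀ᵐ ω ∂M.law N γ, ω.2.2 s j = (γ j s).1 (info T s j ω) := by
  have hmeas := measurableSet_action_eq (X := X) γ s j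
  rw [M.law_eq_run_comp_preLaw γ hs]
  refine Measure.ae_comp_of_ae_ae hmeas (ae_of_all _ fun ω ↦
    M.ae_run_of_agree γ hmeas fun ω' hω' hu ↦ ?_)
  rw [hu, act, setAction_action, hω'.info_eq hT le_rfl]

end ActionEq

lemma pathCostToGo_join_isLowerBounded (N : ℕ) (γ : Profile Y U T) (k : ι) (t : ℕ) :
    IsLowerBounded fun p : Info Y U T t k × Hidden X Y U T t k ↦
      M.pathCostToGo N γ t (join T t k p.1 p.2) :=
  (M.pathCostToGo_isLowerBounded N γ t).comp (measurable_join t k)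

lemma dpCost_last (N : ℕ) (γ : Profile Y U T) (k : ι) (W : ∀ t, Info Y U T t k → EReal)
    (ξ : ProbabilityMeasure (Hidden X Y U T N k)) (i : Info Y U T N k) (u : U N k) :
    M.dpCost N γ k W N ξ i u =
      eint (ξ : Measure (Hidden X Y U T N k)) (M.actionCost γ k N i u) := by
  rw [dpCost, if_neg (lt_irrefl _), add_zero]

variable [∀ t, StandardBorelSpace (X t)] [∀ t j, StandardBorelSpace (Y t j)]
  [∀ t j, StandardBorelSpace (U t j)]

lemma ae_posterior_join_of_ae_law (hT : 1 ≤ T) (γ : Profile Y U T) (k : ι) {t N : ℕ}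
    (ht : t ≤ N) {p : Path X Y U → Prop} (hp : MeasurableSet {ω | p ω})
    (hcongr : ∀ ω ω', Agree t t ω ω' → (p ω ↔ p ω')) (h : ∀ᵐ ω ∂M.law N γ, p ω) :
    ∀ᵐ ω ∂M.law N γ, ∀ᵐ h ∂M.posteriorKernel γ k t (info T t k ω),
      p (join T t k (info T t k ω) h) := by
  have hinfo : Measurable (info T t k : Path X Y U → _) := measurable_info t k
  have hpair : Measurable fun ω : Path X Y U ↦ (info T t k ω, hidden T t k ω) :=
    hinfo.prodMk (measurable_hidden t k)
  have hjoin : ∀ᵐ q ∂(M.law N γ).map (fun ω ↦ (info T t k ω, hidden T t k ω)),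
      p (join T t k q.1 q.2) := by
    refine (ae_map_iff hpair.aemeasurable (measurable_join t k hp)).mpr ?_
    filter_upwards [h] with ω hω using (hcongr _ _ (agree_join t k ω)).mp hω
  rw [M.map_info_hidden_law γ k t hT ht] at hjoin
  exact ae_of_ae_map hinfo.aemeasurable (Measure.ae_ae_of_ae_compProd hjoin)

lemma ae_shared_action (hT : 1 ≤ T) (γ : Profile Y U T) (k : ι) {t N s : ℕ} (ht : t < N)
    (hs : s + T = t + 1) :
    ∀ᵐ ω ∂M.law N γ, ∀ᵐ h ∂M.posteriorKernel γ k t (info T t k ω), ∀ u, ∀ j, j ≠ k →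
      (afterAction γ k t (info T t k ω) h u).2.2 s j =
        (γ j s).1 (info T s j (afterAction γ k t (info T t k ω) h u)) := by
  rcases (show s ≤ t by omega).eq_or_lt with rfl | hst
  · refine ae_of_all _ fun ω ↦ ae_of_all _ fun h u j hj ↦ ?_
    rw [afterAction_action, jointAction_of_ne _ _ _ _ _ _ hj,
      info_afterAction_of_ne hT γ k s _ h u ⟨j, hj⟩]
  · have hcongr (ω ω' : Path X Y U) (h : Agree t t ω ω') :
        (∀ j, ω.2.2 s j = (γ j s).1 (info T s j ω)) ↔
          ∀ j, ω'.2.2 s j = (γ j s).1 (info T s j ω') := by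
      simp only [h.2.2 s hst, h.info_eq hT hst.le]
    have hjoin := M.ae_posterior_join_of_ae_law hT γ k ht.le
      (by simpa only [Set.ofPred_forall] using
        MeasurableSet.iInter fun j ↦ measurableSet_action_eq γ s j)
      hcongr (ae_all_iff.mpr fun j ↦ M.ae_law_action_eq hT γ (hst.le.trans ht.le) j)
    filter_upwards [hjoin] with ω hω
    filter_upwards [hω] with h hh u j _
    have hagree := agree_setAction t (join T t k (info T t k ω) h)
      (jointAction γ k t (info T t k ω).1 h.2 u)
    exact (hcongr _ _ (hagree.mono t.zero_le le_rfl)).mp hh j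

lemma ae_shared_action_update (hT : 1 ≤ T) (γ : Profile Y U T) (k : ι) (g : Strategy Y U T k)
    {t N s : ℕ} (ht : t < N) (hs : s + T = t + 1) :
    ∀ᵐ ω ∂M.law N (Function.update γ k g), ∀ᵐ h ∂M.posteriorKernel γ k t (info T t k ω),
      ∀ u, ∀ j, j ≠ k → (afterAction γ k t (info T t k ω) h u).2.2 s j =
        (γ j s).1 (info T s j (afterAction γ k t (info T t k ω) h u)) := by
  have h := M.ae_shared_action hT (Function.update γ k g) k ht hs
  simp only [posteriorKernel_update, afterAction_update] at h
  filter_upwards [h] with ω hω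
  filter_upwards [hω] with h hh u j hj
  rw [hh u j hj, Function.update_of_ne hj]

lemma costToGo_eq (N : ℕ) (γ : Profile Y U T) (k : ι) (t : ℕ) (i : Info Y U T t k) :
    M.costToGo N γ k t i = eint (M.posteriorKernel γ k t i)
      fun h ↦ M.pathCostToGo N γ t (join T t k i h) := by
  have hjoin : Measurable (join T t k i : Hidden X Y U T t k → Path X Y U) :=
    (measurable_join t k).comp measurable_prodMk_left
  have := Measure.isProbabilityMeasure_map (μ := M.posteriorKernel γ k t i) hjoin.aemeasurable
  calc M.costToGo N γ k t i
      = eint ((M.posteriorKernel γ k t i).map (join T t k i)) (M.pathCostToGo N γ t) :=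
        eint_comp (M.pathCost_isLowerBounded N t)
    _ = _ := eint_map hjoin (M.pathCostToGo_isLowerBounded N γ t).measurable

lemma costToGo_isLowerBounded (N : ℕ) (γ : Profile Y U T) (k : ι) (t : ℕ) :
    IsLowerBounded (M.costToGo N γ k t) := by
  simpa only [← costToGo_eq] using
    (M.pathCostToGo_join_isLowerBounded N γ k t).eint_kernel (κ := M.posteriorKernel γ k t)

lemma costToGo_congr {N : ℕ} {γ γ' : Profile Y U T} {k : ι} {t : ℕ}
    (hp : M.posterior γ k t = M.posterior γ' k t) (h : ∀ s ≥ t, ∀ j, γ j s = γ' j s) :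
    M.costToGo N γ k t = M.costToGo N γ' k t := by
  funext i
  rw [costToGo, costToGo, condLaw, condLaw, hp, M.run_congr h]

lemma eint_stepKernel (γ : Profile Y U T) (k : ι) (t : ℕ) (i : Info Y U T t k) (u : U t k)
    {f : Path X Y U → EReal} (hf : IsLowerBounded f) :
    eint (M.stepKernel γ k t (i, u)) f = eint (M.posteriorKernel γ k t i)
      fun h ↦ eint (M.advance t (afterAction γ k t i h u)) f := by
  have hafter := measurable_afterAction_right (X := X) γ k t i u
  have := Measure.isProbabilityMeasure_map (μ := M.posteriorKernel γ k t i) hafter.aemeasurable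
  rw [stepKernel_apply]
  exact (eint_comp hf).trans (eint_map hafter
    (IsLowerBounded.eint_kernel (f := fun p : Path X Y U × Path X Y U ↦ f p.2)
      (hf.comp measurable_snd)).measurable)

lemma eint_stepKernel_pathCostToGo (hT : 1 ≤ T) (γ : Profile Y U T) (k : ι) {t N : ℕ}
    (ht : t < N) (i : Info Y U T t k) (u : U t k) :
    eint (M.stepKernel γ k t (i, u)) (M.pathCostToGo N γ (t + 1)) =
      eint ((M.stepKernel γ k t (i, u)).map (info T (t + 1) k)) (M.costToGo N γ k (t + 1)) := by
  have hinfo : Measurable (info T (t + 1) k : Path X Y U → _) := measurable_info (t + 1) k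
  have hcost := M.pathCostToGo_join_isLowerBounded N γ k (t + 1)
  have := Measure.isProbabilityMeasure_map (μ := M.stepKernel γ k t (i, u)) hinfo.aemeasurable
  calc eint (M.stepKernel γ k t (i, u)) (M.pathCostToGo N γ (t + 1))
      = eint (M.stepKernel γ k t (i, u)) fun ω ↦ M.pathCostToGo N γ (t + 1)
          (join T (t + 1) k (info T (t + 1) k ω) (hidden T (t + 1) k ω)) := by
        simp only [← M.pathCostToGo_congr hT γ ht (agree_join (t + 1) k _)]
    _ = eint ((M.stepKernel γ k t (i, u)).map (info T (t + 1) k) ⊗ₘ M.posteriorKernel γ k (t + 1))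
          fun p ↦ M.pathCostToGo N γ (t + 1) (join T (t + 1) k p.1 p.2) := by
        rw [← M.map_info_hidden_stepKernel γ k t hT,
          eint_map (hinfo.prodMk (measurable_hidden (t + 1) k)) hcost.measurable]
    _ = _ := by
        rw [eint_compProd hcost]
        simp only [← costToGo_eq]

lemma eint_map_info_stepKernel (hT : 1 ≤ T) (γ : Profile Y U T) (k : ι) (t : ℕ)
    (i : Info Y U T t k) (u : U t k) {f : Info Y U T (t + 1) k → EReal} (hf : Measurable f) :
    eint ((M.stepKernel γ k t (i, u)).map (info T (t + 1) k)) f =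
      eint (M.infoTransition γ k t (i, u)) fun z ↦ f (nextInfo γ k t i z.1 u z.2.2) := by
  rw [M.map_info_stepKernel γ k t hT, eint_map (measurable_nextInfo γ k t i u) hf]

lemma dpCost_posterior_of_lt (hT : 1 ≤ T) {N : ℕ} (γ : Profile Y U T) (k : ι)
    {W : ∀ t, Info Y U T t k → EReal} {t : ℕ} (ht : t < N) (hW : Measurable (W (t + 1)))
    (i : Info Y U T t k) (u : U t k) :
    M.dpCost N γ k W t (M.posterior γ k t i) i u =
      eint (M.posteriorKernel γ k t i) (M.actionCost γ k t i u) +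
        eint ((M.stepKernel γ k t (i, u)).map (info T (t + 1) k)) (W (t + 1)) := by
  rw [dpCost, if_pos ht, M.eint_map_info_stepKernel hT γ k t i u hW]
  rfl

lemma costToGo_eq_dpCost (hT : 1 ≤ T) (γ : Profile Y U T) (k : ι) {t N : ℕ} (ht : t ≤ N)
    (i : Info Y U T t k) :
    M.costToGo N γ k t i =
      M.dpCost N γ k (M.costToGo N γ k) t (M.posterior γ k t i) i ((γ k t).1 i) := by
  set u := (γ k t).1 i
  have hact (h : Hidden X Y U T t k) :
      (act γ t (join T t k i h)).2.2 t = jointAction γ k t i.1 h.2 u := by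
    rw [act_join, afterAction_action]
  have hstate (h : Hidden X Y U T t k) : (join T t k i h).1 t = h.1 := by simp [join, fill]
  rcases ht.eq_or_lt with rfl | ht
  · rw [costToGo_eq, dpCost_last]
    simp only [pathCostToGo_self, hact, hstate]
    rfl
  · have hnext := M.pathCostToGo_isLowerBounded N γ (t + 1)
    have hstep (h : Hidden X Y U T t k) : M.pathCostToGo N γ t (join T t k i h) =
        M.actionCost γ k t i u h +
          eint (M.advance t (afterAction γ k t i h u)) (M.pathCostToGo N γ (t + 1)) := by
      rw [M.pathCostToGo_of_lt γ ht, hact, hstate, act_join]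
      rfl
    have hadvance : IsLowerBounded fun h ↦
        eint (M.advance t (afterAction γ k t i h u)) (M.pathCostToGo N γ (t + 1)) :=
      (IsLowerBounded.eint_kernel (κ := M.advance t)
        (f := fun p : Path X Y U × Path X Y U ↦ M.pathCostToGo N γ (t + 1) p.2)
        (hnext.comp measurable_snd)).comp
          (measurable_afterAction_right γ k t i u)
    rw [costToGo_eq, M.dpCost_posterior_of_lt hT γ k ht
      (M.costToGo_isLowerBounded N γ k (t + 1)).measurable,
      ← M.eint_stepKernel_pathCostToGo hT γ k ht, M.eint_stepKernel γ k t i u hnext]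
    simp only [hstep]
    exact eint_add (M.actionCost_isLowerBounded γ k t i u) hadvance

lemma isCondExpectation_costToGo (hT : 1 ≤ T) (γ : Profile Y U T) (k : ι) {t N : ℕ}
    (ht : t ≤ N) :
    IsCondExpectation (M.law N γ) (info T t k) (M.pathCost N t) (M.costToGo N γ k t) := by
  refine ⟨(M.costToGo_isLowerBounded N γ k t).measurable, fun A hA ↦ ?_⟩
  have hcond := isCondExpectation_of_map_eq_compProd (measurable_info t k) (measurable_hidden t k)
    (M.map_info_hidden_law γ k t hT ht) (M.pathCostToGo_join_isLowerBounded N γ k t)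
  simp only [← costToGo_eq, ← M.pathCostToGo_congr hT γ ht (agree_join t k _)] at hcond
  rw [← hcond.2 A hA]
  exact M.eint_law_indicator_pathCost hT γ ht (measurable_info t k hA)
    fun ω ω' h ↦ by simp only [Set.mem_preimage, h.info_eq hT le_rfl]

lemma payoff_eq (hT : 1 ≤ T) (γ : Profile Y U T) (k : ι) (N : ℕ) :
    M.payoff N γ = eint (M.initLaw.map (info T 0 k)) (M.costToGo N γ k 0) := by
  have hcost := (M.isCondExpectation_costToGo hT γ k N.zero_le).2 Set.univ MeasurableSet.univ
  simp only [Set.preimage_univ, Set.indicator_univ] at hcost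
  rw [payoff, hcost, ← eint_map (measurable_info 0 k)
    (M.costToGo_isLowerBounded N γ k 0).measurable,
    M.map_law γ N.zero_le (measurable_info 0 k) fun _ _ h ↦ h.info_eq hT le_rfl k]
  rfl

end Network

end CostToGo

lemma backward_induction {N : ℕ} {p : ℕ → Prop} (h : ∀ t ≤ N, (t < N → p (t + 1)) → p t) {t : ℕ}
    (ht : t ≤ N) : p t :=
  Nat.decreasingInduction (motive := fun t _ ↦ p t) (fun t ht ih ↦ h t ht.le fun _ ↦ ih)
    (h N le_rfl fun hlt ↦ absurd hlt (lt_irrefl _)) ht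

section DynamicProgramming

variable {ι : Type*} [Fintype ι] [DecidableEq ι] {X : ℕ → Type*} {Y U : ℕ → ι → Type*}
  [∀ t, MeasurableSpace (X t)] [∀ t j, MeasurableSpace (Y t j)] [∀ t j, MeasurableSpace (U t j)]
  [∀ t, Nonempty (X t)] [∀ t j, Nonempty (Y t j)] [∀ t j, Nonempty (U t j)] {T : ℕ}

namespace Network

variable (M : Network ι X Y U)

section DPCost

variable {N : ℕ} {γ : Profile Y U T} {k : ι} {W W' : ∀ t, Info Y U T t k → EReal} {t : ℕ}

lemma dpCost_mono (h : t < N → ∀ i, W (t + 1) i ≤ W' (t + 1) i)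
    (ξ : ProbabilityMeasure (Hidden X Y U T t k)) (i : Info Y U T t k) (u : U t k) :
    M.dpCost N γ k W t ξ i u ≤ M.dpCost N γ k W' t ξ i u := by
  unfold dpCost
  split_ifs with ht
  · gcongr
    exact eint_mono fun z ↦ h ht _
  · exact le_rfl

lemma dpCost_congr (h : t < N → ∀ i, W (t + 1) i = W' (t + 1) i)
    (ξ : ProbabilityMeasure (Hidden X Y U T t k)) (i : Info Y U T t k) (u : U t k) :
    M.dpCost N γ k W t ξ i u = M.dpCost N γ k W' t ξ i u :=
  (M.dpCost_mono (fun ht i ↦ (h ht i).le) ξ i u).antisymm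
    (M.dpCost_mono (fun ht i ↦ (h ht i).ge) ξ i u)

lemma dpCost_update (g : Strategy Y U T k) (ξ : ProbabilityMeasure (Hidden X Y U T t k))
    (i : Info Y U T t k) (u : U t k) :
    M.dpCost N (Function.update γ k g) k W t ξ i u = M.dpCost N γ k W t ξ i u := by
  unfold dpCost actionCost nextInfo
  simp only [transition_update, jointAction_update, afterAction_update]

end DPCost

variable [∀ t, StandardBorelSpace (X t)] [∀ t j, StandardBorelSpace (Y t j)]
  [∀ t j, StandardBorelSpace (U t j)]

lemma costToGo_update_eq_dpCost (hT : 1 ≤ T) (γ : Profile Y U T) (k : ι) (g : Strategy Y U T k)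
    {t N : ℕ} (ht : t ≤ N) (i : Info Y U T t k) :
    M.costToGo N (Function.update γ k g) k t i =
      M.dpCost N γ k (M.costToGo N (Function.update γ k g) k) t (M.posterior γ k t i) i
        ((g t).1 i) := by
  rw [M.costToGo_eq_dpCost hT _ k ht, dpCost_update, posterior_update, Function.update_self]

lemma payoff_le_of_costToGo_le (hT : 1 ≤ T) {γ γ' : Profile Y U T} (k : ι) {N : ℕ}
    (h : ∀ i, M.costToGo N γ k 0 i ≤ M.costToGo N γ' k 0 i) : M.payoff N γ ≤ M.payoff N γ' := by
  rw [M.payoff_eq hT γ k, M.payoff_eq hT γ' k]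
  exact eint_mono h

section Value

lemma value_eq_iInf (N : ℕ) (γ : Profile Y U T) (k : ι) (t : ℕ) (i : Info Y U T t k) :
    M.value N γ k t i = ⨅ g : Strategy Y U T k, M.costToGo N (Function.update γ k g) k t i := by
  refine le_antisymm (le_iInf fun g ↦ ?_) (le_iInf fun g ↦ iInf_le _ g.1)
  let g' : Strategy Y U T k := fun s ↦ if s < t then γ k s else g s
  have hg' : ∀ s < t, g' s = γ k s := fun s hs ↦ if_pos hs
  refine (iInf_le _ (⟨g', hg'⟩ : {g : Strategy Y U T k // ∀ s < t, g s = γ k s})).trans_eq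
    (congrFun (M.costToGo_congr (by rw [posterior_update, posterior_update]) fun s hs j ↦ ?_) i)
  rcases eq_or_ne j k with rfl | hj
  · rw [Function.update_self, Function.update_self]
    exact if_neg hs.not_gt
  · rw [Function.update_of_ne hj, Function.update_of_ne hj]

lemma value_update (N : ℕ) (γ : Profile Y U T) (k : ι) (g : Strategy Y U T k) (t : ℕ)
    (i : Info Y U T t k) : M.value N (Function.update γ k g) k t i = M.value N γ k t i := by
  simp only [value_eq_iInf, Function.update_idem]

lemma value_le_costToGo_update (N : ℕ) (γ : Profile Y U T) (k : ι) (g : Strategy Y U T k) (t : ℕ)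
    (i : Info Y U T t k) : M.value N γ k t i ≤ M.costToGo N (Function.update γ k g) k t i := by
  rw [value_eq_iInf]
  exact iInf_le _ g

lemma value_le_costToGo (N : ℕ) (γ : Profile Y U T) (k : ι) (t : ℕ) (i : Info Y U T t k) :
    M.value N γ k t i ≤ M.costToGo N γ k t i := by
  simpa only [Function.update_eq_self] using M.value_le_costToGo_update N γ k (γ k) t i

lemma dpCost_value_le_costToGo (hT : 1 ≤ T) (γ : Profile Y U T) (k : ι) {t N : ℕ} (ht : t ≤ N)
    (i : Info Y U T t k) :
    M.dpCost N γ k (M.value N γ k) t (M.posterior γ k t i) i ((γ k t).1 i) ≤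
      M.costToGo N γ k t i := by
  rw [M.costToGo_eq_dpCost hT γ k ht]
  exact M.dpCost_mono (fun _ ↦ M.value_le_costToGo N γ k (t + 1)) _ i _

lemma iInf_dpCost_value_le_value (hT : 1 ≤ T) (γ : Profile Y U T) (k : ι) {t N : ℕ} (ht : t ≤ N)
    (i : Info Y U T t k) :
    ⨅ u, M.dpCost N γ k (M.value N γ k) t (M.posterior γ k t i) i u ≤ M.value N γ k t i := by
  rw [value_eq_iInf]
  refine le_iInf fun g ↦ (iInf_le _ ((g t).1 i)).trans ?_
  rw [M.costToGo_update_eq_dpCost hT γ k g ht]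
  exact M.dpCost_mono (fun _ ↦ M.value_le_costToGo_update N γ k g (t + 1)) _ i _

end Value

section Verification

variable {M} {N : ℕ} {γ : Profile Y U T} {k : ι} {W : ∀ t, Info Y U T t k → EReal} {t : ℕ}

lemma IsDPSolution.le_costToGo (hT : 1 ≤ T) (hW : M.IsDPSolution N γ k W) (g : Strategy Y U T k)
    (ht : t ≤ N) : ∀ i, W t i ≤ M.costToGo N (Function.update γ k g) k t i := by
  refine backward_induction (p := fun t ↦ ∀ i, W t i ≤ M.costToGo N (Function.update γ k g) k t i)
    (fun t ht ih i ↦ ?_) ht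
  calc W t i = ⨅ u, M.dpCost N γ k W t (M.posterior γ k t i) i u := (hW t ht).2 i
    _ ≤ M.dpCost N γ k W t (M.posterior γ k t i) i ((g t).1 i) := iInf_le _ _
    _ ≤ M.dpCost N γ k (M.costToGo N (Function.update γ k g) k) t (M.posterior γ k t i) i
          ((g t).1 i) := M.dpCost_mono ih _ i _
    _ = M.costToGo N (Function.update γ k g) k t i :=
        (M.costToGo_update_eq_dpCost hT γ k g ht i).symm

lemma IsDPSolution.eq_costToGo (hT : 1 ≤ T) (hW : M.IsDPSolution N γ k W)
    (hmin : M.IsMinimizer N γ k W (γ k)) (ht : t ≤ N) : ∀ i, W t i = M.costToGo N γ k t i := by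
  refine backward_induction (p := fun t ↦ ∀ i, W t i = M.costToGo N γ k t i)
    (fun t ht ih i ↦ ?_) ht
  rw [(hW t ht).2 i, ← hmin t ht i, M.costToGo_eq_dpCost hT γ k ht]
  exact M.dpCost_congr ih _ i _

lemma IsDPSolution.eq_value (hT : 1 ≤ T) (hW : M.IsDPSolution N γ k W)
    (hmin : M.IsMinimizer N γ k W (γ k)) (ht : t ≤ N) (i : Info Y U T t k) :
    W t i = M.value N γ k t i := by
  refine le_antisymm ?_ ?_
  · rw [value_eq_iInf]
    exact le_iInf fun g ↦ hW.le_costToGo hT g ht i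
  · rw [hW.eq_costToGo hT hmin ht]
    exact M.value_le_costToGo N γ k t i

lemma isEquilibrium_of_isMinimizer (hT : 1 ≤ T) {W : ∀ k t, Info Y U T t k → EReal}
    (hW : ∀ k, M.IsDPSolution N γ k (W k)) (hmin : ∀ k, M.IsMinimizer N γ k (W k) (γ k)) :
    M.IsEquilibrium N γ := by
  refine fun k g ↦ M.payoff_le_of_costToGo_le hT k fun i ↦ ?_
  rw [← (hW k).eq_costToGo hT (hmin k) N.zero_le]
  exact (hW k).le_costToGo hT g N.zero_le i

end Verification

section Optimality

variable {M} {N : ℕ} {γ : Profile Y U T} {k : ι} {g : Strategy Y U T k} {t : ℕ}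

lemma IsMinimizer.costToGo_eq_value (hT : 1 ≤ T) (hg : M.IsMinimizer N γ k (M.value N γ k) g)
    (ht : t ≤ N) : ∀ i, M.costToGo N (Function.update γ k g) k t i = M.value N γ k t i := by
  refine backward_induction
    (p := fun t ↦ ∀ i, M.costToGo N (Function.update γ k g) k t i = M.value N γ k t i)
    (fun t ht ih i ↦ le_antisymm ?_ (M.value_le_costToGo_update N γ k g t i)) ht
  rw [M.costToGo_update_eq_dpCost hT γ k g ht, M.dpCost_congr ih, hg t ht i]
  exact M.iInf_dpCost_value_le_value hT γ k ht i

lemma IsMinimizer.value_eq_iInf_dpCost (hT : 1 ≤ T)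
    (hg : M.IsMinimizer N γ k (M.value N γ k) g) (ht : t ≤ N) (i : Info Y U T t k) :
    M.value N γ k t i = ⨅ u, M.dpCost N γ k (M.value N γ k) t (M.posterior γ k t i) i u := by
  rw [← hg t ht i, ← hg.costToGo_eq_value hT ht, M.costToGo_update_eq_dpCost hT γ k g ht]
  exact M.dpCost_congr (fun hlt ↦ hg.costToGo_eq_value hT hlt) _ i _

lemma IsMinimizer.value_isLowerBounded (hT : 1 ≤ T)
    (hg : M.IsMinimizer N γ k (M.value N γ k) g) (ht : t ≤ N) :
    IsLowerBounded (M.value N γ k t) :=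
  funext (hg.costToGo_eq_value hT ht) ▸ M.costToGo_isLowerBounded N _ k t

lemma IsMinimizer.isDPSolution (hT : 1 ≤ T) (hg : M.IsMinimizer N γ k (M.value N γ k) g) :
    M.IsDPSolution N γ k (M.value N γ k) :=
  fun _ ht ↦ ⟨(hg.value_isLowerBounded hT ht).measurable, hg.value_eq_iInf_dpCost hT ht⟩

lemma IsMinimizer.value_last (hT : 1 ≤ T) (hg : M.IsMinimizer N γ k (M.value N γ k) g)
    (i : Info Y U T N k) :
    M.value N γ k N i = ⨅ u : U N k,
      eint (M.posteriorKernel γ k N i) (M.actionCost γ k N i u) := by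
  rw [hg.value_eq_iInf_dpCost hT le_rfl]
  simp only [dpCost_last]
  rfl

lemma fst_infoTransition (γ : Profile Y U T) (k : ι) (t : ℕ) (i : Info Y U T t k) (u : U t k) :
    (M.infoTransition γ k t (i, u)).map Prod.fst = M.posteriorKernel γ k t i := by
  rw [infoTransition, Kernel.comap_apply, transition, ← Kernel.map_apply _ measurable_fst,
    ← Kernel.fst_eq, Kernel.fst_compProd]
  rfl

lemma dpCost_eq_eint_infoTransition {W : ∀ t, Info Y U T t k → EReal} (ht : t < N)
    (hW : IsLowerBounded (W (t + 1))) (i : Info Y U T t k) (u : U t k) :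
    M.dpCost N γ k W t (M.posterior γ k t i) i u =
      eint (M.infoTransition γ k t (i, u)) fun z ↦
        M.actionCost γ k t i u z.1 + W (t + 1) (nextInfo γ k t i z.1 u z.2.2) := by
  have hcost := M.actionCost_isLowerBounded γ k t i u
  rw [eint_add (hcost.comp measurable_fst) (hW.comp (measurable_nextInfo γ k t i u)),
    ← eint_map measurable_fst hcost.measurable, fst_infoTransition, dpCost, if_pos ht]
  rfl

lemma IsMinimizer.value_of_lt (hT : 1 ≤ T) (hg : M.IsMinimizer N γ k (M.value N γ k) g)
    (ht : t < N) (i : Info Y U T t k) :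
    M.value N γ k t i = ⨅ u : U t k, eint (M.infoTransition γ k t (i, u)) fun z ↦
      M.actionCost γ k t i u z.1 + M.value N γ k (t + 1) (nextInfo γ k t i z.1 u z.2.2) := by
  rw [hg.value_eq_iInf_dpCost hT ht.le]
  exact iInf_congr (dpCost_eq_eint_infoTransition ht (hg.value_isLowerBounded hT ht) i)

lemma HasSelectors.exists_isSemiSeparated {W : ∀ t, Info Y U T t k → EReal}
    (h : M.HasSelectors N γ k W) :
    ∃ g : Strategy Y U T k, M.IsSemiSeparated N γ k g ∧ M.IsMinimizer N γ k W g := by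
  choose σ hσm hσ using h
  have hpost (t : ℕ) : Measurable (M.posterior γ k t) := M.measurable_posterior γ k t
  -- `dpCost N` depends on `i` through its shared part only, so any private part will do.
  let g : Strategy Y U T k := fun t ↦
    if ht : t ≤ N then
      if t < N then ⟨fun i ↦ σ t ht (M.posterior γ k t i, i),
        (hσm t ht).comp ((hpost t).prodMk measurable_id)⟩
      else ⟨fun i ↦ σ t ht (M.posterior γ k t i, i.1, Classical.arbitrary _),
        (hσm t ht).comp ((hpost t).prodMk (measurable_fst.prodMk measurable_const))⟩
    else γ k t
  have hlt (t : ℕ) (ht : t < N) (i : Info Y U T t k) :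
      (g t).1 i = σ t ht.le (M.posterior γ k t i, i) := by simp [g, ht, ht.le]
  have hlast (i : Info Y U T N k) :
      (g N).1 i = σ N le_rfl (M.posterior γ k N i, i.1, Classical.arbitrary _) := by simp [g]
  refine ⟨g, ⟨fun t ht ↦ ⟨σ t ht.le, hσm t ht.le, hlt t ht⟩,
    fun p ↦ σ N le_rfl (p.1, p.2, Classical.arbitrary _),
    (hσm N le_rfl).comp (by fun_prop), hlast⟩, fun t ht i ↦ ?_⟩
  rcases ht.eq_or_lt with rfl | ht
  · have hmin := hσ t le_rfl (M.posterior γ k t i) (i.1, Classical.arbitrary _)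
    rw [hlast i]
    simp only [dpCost_last] at hmin ⊢
    exact hmin
  · rw [hlt t ht i, hσ t ht.le]

lemma IsMinimizer.payoff_le (hT : 1 ≤ T) (hg : M.IsMinimizer N γ k (M.value N γ k) g) :
    M.payoff N (Function.update γ k g) ≤ M.payoff N γ := by
  refine M.payoff_le_of_costToGo_le hT k fun i ↦ ?_
  rw [hg.costToGo_eq_value hT N.zero_le]
  exact M.value_le_costToGo N γ k 0 i

lemma ae_preLaw_succ_of_ae_stepKernel (hT : 1 ≤ T) {p : Info Y U T (t + 1) k → Prop}
    (hp : MeasurableSet {i | p i})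
    (h : ∀ᵐ i ∂(M.preLaw γ t).map (info T t k),
      ∀ᵐ i' ∂(M.stepKernel γ k t (i, (γ k t).1 i)).map (info T (t + 1) k), p i') :
    ∀ᵐ i ∂(M.preLaw γ (t + 1)).map (info T (t + 1) k), p i := by
  have hinfo : Measurable (info T (t + 1) k : Path X Y U → _) := measurable_info (t + 1) k
  have hact : Measurable fun i : Info Y U T t k ↦ (i, (γ k t).1 i) :=
    measurable_id.prodMk (γ k t).2
  have hset : MeasurableSet {q | ∀ᵐ ω ∂M.stepKernel γ k t q, p (info T (t + 1) k ω)} :=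
    (M.stepKernel γ k t).measurable_coe (hinfo hp).compl (measurableSet_singleton 0)
  rw [M.map_preLaw_succ γ k hT (M.map_info_hidden_preLaw γ k t hT) hinfo
    fun ω ω' h ↦ h.info_eq hT le_rfl k, ae_map_iff hinfo.aemeasurable hp]
  refine Measure.ae_comp_of_ae_ae (hinfo hp) ?_
  change ∀ᵐ q ∂(M.preLaw γ t).map ((fun i ↦ (i, (γ k t).1 i)) ∘ info T t k), _
  rw [← Measure.map_map hact (measurable_info t k), ae_map_iff hact.aemeasurable hset]
  simpa only [ae_map_iff hinfo.aemeasurable hp] using h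

lemma IsMinimizer.ae_stepKernel_costToGo_eq_value (hT : 1 ≤ T)
    (hg : M.IsMinimizer N γ k (M.value N γ k) g) (ht : t < N) {i : Info Y U T t k}
    (heq : M.costToGo N γ k t i = M.value N γ k t i) (hfin : M.costToGo N γ k t i < ⊤) :
    ∀ᵐ i' ∂(M.stepKernel γ k t (i, (γ k t).1 i)).map (info T (t + 1) k),
      M.costToGo N γ k (t + 1) i' = M.value N γ k (t + 1) i' ∧
        M.costToGo N γ k (t + 1) i' < ⊤ := by
  have hvalue := hg.value_isLowerBounded hT ht
  have hcost := M.costToGo_isLowerBounded N γ k (t + 1)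
  have hcostToGo := M.costToGo_eq_dpCost hT γ k ht.le i
  have hle : M.costToGo N γ k t i ≤
      M.dpCost N γ k (M.value N γ k) t (M.posterior γ k t i) i ((γ k t).1 i) := by
    rw [heq, hg.value_eq_iInf_dpCost hT ht.le]
    exact iInf_le _ _
  rw [M.dpCost_posterior_of_lt hT γ k ht hcost.measurable] at hcostToGo
  rw [M.dpCost_posterior_of_lt hT γ k ht hvalue.measurable, hcostToGo] at hle
  exact ae_eq_and_lt_top_of_add_eint_le hvalue hcost (M.value_le_costToGo N γ k (t + 1))
    (M.actionCost_isLowerBounded γ k t i _).eint_ne_bot hle (hcostToGo ▸ hfin)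

lemma IsMinimizer.ae_costToGo_eq_value (hT : 1 ≤ T)
    (hg : M.IsMinimizer N γ k (M.value N γ k) g)
    (hopt : M.payoff N γ ≤ M.payoff N (Function.update γ k g)) (hfin : M.payoff N γ < ⊤)
    (ht : t ≤ N) :
    ∀ᵐ i ∂(M.preLaw γ t).map (info T t k),
      M.costToGo N γ k t i = M.value N γ k t i ∧ M.costToGo N γ k t i < ⊤ := by
  have hcost := M.costToGo_isLowerBounded N γ k t
  have hvalue := hg.value_isLowerBounded hT ht
  induction t with
  | zero =>
    rw [M.payoff_eq hT _ k, M.payoff_eq hT _ k, funext (hg.costToGo_eq_value hT ht)] at hopt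
    rw [M.payoff_eq hT _ k] at hfin
    filter_upwards [ae_eq_of_eint_le hvalue hcost (M.value_le_costToGo N γ k 0) hopt
      ((eint_mono (M.value_le_costToGo N γ k 0)).trans_lt hfin),
      ae_lt_top_of_eint_lt_top hcost hfin] with i heq hlt using ⟨heq.symm, hlt⟩
  | succ t ih =>
    refine ae_preLaw_succ_of_ae_stepKernel hT
      ((measurableSet_eq_fun hcost.measurable hvalue.measurable).inter
        (measurableSet_lt hcost.measurable measurable_const)) ?_
    filter_upwards [ih (Nat.le_of_succ_le ht) (M.costToGo_isLowerBounded N γ k t)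
      (hg.value_isLowerBounded hT (Nat.le_of_succ_le ht))] with i hi
    exact hg.ae_stepKernel_costToGo_eq_value hT ht hi.1 hi.2

lemma IsMinimizer.ae_isOptimal (hT : 1 ≤ T) (hg : M.IsMinimizer N γ k (M.value N γ k) g)
    (hopt : M.payoff N γ ≤ M.payoff N (Function.update γ k g)) (hfin : M.payoff N γ < ⊤)
    (ht : t ≤ N) :
    ∀ᵐ ω ∂M.law N γ,
      M.costToGo N γ k t (info T t k ω) = M.value N γ k t (info T t k ω) ∧
      M.dpCost N γ k (M.value N γ k) t (M.posterior γ k t (info T t k ω)) (info T t k ω)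
          ((γ k t).1 (info T t k ω)) =
        ⨅ u : U t k, M.dpCost N γ k (M.value N γ k) t (M.posterior γ k t (info T t k ω))
          (info T t k ω) u := by
  have hinfo : Measurable (info T t k : Path X Y U → _) := measurable_info t k
  have heq := hg.ae_costToGo_eq_value hT hopt hfin ht
  rw [← M.map_law γ ht hinfo fun _ _ h ↦ h.info_eq hT le_rfl k] at heq
  filter_upwards [ae_of_ae_map hinfo.aemeasurable heq] with ω hω
  refine ⟨hω.1, le_antisymm ?_ (iInf_le _ _)⟩
  rw [← hg.value_eq_iInf_dpCost hT ht, ← hω.1]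
  exact M.dpCost_value_le_costToGo hT γ k ht _

end Optimality

end Network

end DynamicProgramming

end DelayedSharing

end

theorem mainTheorem2 {ι : Type*} [Fintype ι] [DecidableEq ι]
    {X : ℕ → Type*} {Y U : ℕ → ι → Type*}
    [∀ t, MeasurableSpace (X t)] [∀ t j, MeasurableSpace (Y t j)]
    [∀ t j, MeasurableSpace (U t j)]
    [∀ t, StandardBorelSpace (X t)] [∀ t j, StandardBorelSpace (Y t j)]
    [∀ t j, StandardBorelSpace (U t j)]
    [∀ t, Nonempty (X t)] [∀ t j, Nonempty (Y t j)] [∀ t j, Nonempty (U t j)]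
    (M : Network ι X Y U) (T N : ℕ) (hT : 1 ≤ T) (γ : Profile Y U T) :
    -- The conditional laws given the information of agent `k` do not depend on its strategy `g`.
    (∀ k, ∀ g : Strategy Y U T k,
      (∀ t, M.posterior (Function.update γ k g) k t = M.posterior γ k t) ∧
      (∀ t ≤ N, ∀ᵐ i ∂(M.law N (Function.update γ k g)).map (info T t k),
        condDistrib (hidden T t k) (info T t k) (M.law N (Function.update γ k g)) i =
          M.posteriorKernel γ k t i) ∧
      (∀ t < N, ∀ᵐ p ∂(M.law N (Function.update γ k g)).map
          (fun ω => (info T t k ω, ω.2.2 t k)),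
        condDistrib (fun ω => (hidden T t k ω, ω.1 (t + 1), ω.2.1 (t + 1) k))
            (fun ω => (info T t k ω, ω.2.2 t k)) (M.law N (Function.update γ k g)) p =
          M.infoTransition γ k t p) ∧
      (∀ t ≤ N, IsCondExpectation (M.law N (Function.update γ k g)) (info T t k)
        (M.pathCost N t) (M.costToGo N (Function.update γ k g) k t)) ∧
      -- the actions of the others that become shared are given by `γ^{-k}`
      (∀ t < N, ∀ s, s + T = t + 1 → ∀ᵐ ω ∂M.law N (Function.update γ k g),
        ∀ᵐ h ∂M.posteriorKernel γ k t (info T t k ω), ∀ u, ∀ j, j ≠ k →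
          (afterAction γ k t (info T t k ω) h u).2.2 s j =
            (γ j s).1 (info T s j (afterAction γ k t (info T t k ω) h u)))) ∧
    (∀ t s, s + T = t + 1 → ∀ j, ∀ ω ω' : Path X Y U, common T t ω = common T t ω' →
      ω.2.1 s j = ω'.2.1 s j → info T s j ω = info T s j ω') ∧
    -- (1.1) the value process does not depend on the strategy of agent `k`, and it solves the
    -- dynamic programming equations, in both forms
    (∀ k, ∀ g : Strategy Y U T k, ∀ t ≤ N, ∀ i,
      M.value N (Function.update γ k g) k t i = M.value N γ k t i) ∧
    (∀ k, (∃ g : Strategy Y U T k, M.IsMinimizer N γ k (M.value N γ k) g) →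
      M.IsDPSolution N γ k (M.value N γ k) ∧
      (∀ i, M.value N γ k N i = ⨅ u : U N k,
        eint (M.posteriorKernel γ k N i) (M.actionCost γ k N i u)) ∧
      (∀ t < N, ∀ i, M.value N γ k t i = ⨅ u : U t k,
        eint (M.infoTransition γ k t (i, u)) (fun z => M.actionCost γ k t i u z.1 +
          M.value N γ k (t + 1) (nextInfo γ k t i z.1 u z.2.2)))) ∧
    -- (1.2) semi-separated optimal strategies; an equilibrium strategy achieves the infimum
    (M.IsEquilibrium N γ → ∀ k, M.HasSelectors N γ k (M.value N γ k) →
      M.IsConditionallyMarkov γ k ∧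
      (∃ g : Strategy Y U T k, M.IsSemiSeparated N γ k g ∧
        M.IsMinimizer N γ k (M.value N γ k) g ∧
        (∀ t ≤ N, ∀ i, M.costToGo N (Function.update γ k g) k t i = M.value N γ k t i) ∧
        M.payoff N (Function.update γ k g) = M.payoff N γ) ∧
      (M.payoff N γ < ⊤ → ∀ t ≤ N, ∀ᵐ ω ∂M.law N γ,
        M.costToGo N γ k t (info T t k ω) = M.value N γ k t (info T t k ω) ∧
        M.dpCost N γ k (M.value N γ k) t (M.posterior γ k t (info T t k ω)) (info T t k ω)
            ((γ k t).1 (info T t k ω)) =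
          ⨅ u : U t k, M.dpCost N γ k (M.value N γ k) t (M.posterior γ k t (info T t k ω))
            (info T t k ω) u)) ∧
    -- (2.1) solutions of the dynamic programming equations are lower bounds
    (∀ k, ∀ W : ∀ t, Info Y U T t k → EReal, M.IsDPSolution N γ k W →
      ∀ g : Strategy Y U T k, ∀ t ≤ N, ∀ i,
        W t i ≤ M.costToGo N (Function.update γ k g) k t i) ∧
    -- (2.2) minimizers form an equilibrium
    (∀ W : ∀ k t, Info Y U T t k → EReal,
      (∀ k, M.IsDPSolution N γ k (W k) ∧ M.IsMinimizer N γ k (W k) (γ k)) →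
        M.IsEquilibrium N γ ∧ ∀ k, ∀ t ≤ N, ∀ i,
          W k t i = M.costToGo N γ k t i ∧ W k t i = M.value N γ k t i) := by
  refine ⟨fun k g ↦ ⟨M.posterior_update γ k g,
      fun t ht ↦ M.condDistrib_hidden_update γ k t g hT ht,
      fun t ht ↦ M.condDistrib_next_update γ k t g hT ht,
      fun t ht ↦ M.isCondExpectation_costToGo hT _ k ht,
      fun t ht s hs ↦ M.ae_shared_action_update hT γ k g ht hs⟩,
    fun t s hs j ω ω' h hy ↦ info_eq_of_common_eq hT hs h hy,
    fun k g t _ i ↦ M.value_update N γ k g t i,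
    fun k ⟨g, hg⟩ ↦ ⟨hg.isDPSolution hT, hg.value_last hT, fun t ht ↦ hg.value_of_lt hT ht⟩,
    fun heq k hsel ↦ ?_,
    fun k W hW g t ht ↦ hW.le_costToGo hT g ht,
    fun W hW ↦ ⟨Network.isEquilibrium_of_isMinimizer hT (fun k ↦ (hW k).1) fun k ↦ (hW k).2,
      fun k t ht i ↦ ⟨(hW k).1.eq_costToGo hT (hW k).2 ht i, (hW k).1.eq_value hT (hW k).2 ht i⟩⟩⟩
  obtain ⟨g, hsep, hmin⟩ := hsel.exists_isSemiSeparated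
  exact ⟨M.isConditionallyMarkov γ k,
    ⟨g, hsep, hmin, fun t ht ↦ hmin.costToGo_eq_value hT ht,
      (hmin.payoff_le hT).antisymm (heq k g)⟩,
    fun hfin t ht ↦ hmin.ae_isOptimal hT (heq k g) hfin ht⟩
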